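/- Let $\mathfrak A$ be a $C^*$-algebra, $H$ a Hilbert $\mathfrak A$-module, and $\mathcal L(H)$ the $C^*$-algebra of adjointable operators on $H$. Write $\mathcal R(T)$ and $\mathcal N(T)$ for the range and null space of $T$. For an idempotent $Q\in\mathcal L(H)$, its matched projection is $$m(Q)=\tfrac12\big(|Q^*|+Q^*\big)\,|Q^*|^{\dagger}\,\big(|Q^*|+I\big)^{-1}\big(|Q^*|+Q\big),\qquad |Q^*|=(QQ^*)^{1/2},$$ where $\dagger$ denotes the Moore–Penrose inverse. With $P=m(Q)$, put $$H_1=\mathcal R(P)\cap\mathcal R(Q),\quad H_2=\mathcal R(P)\cap\mathcal N(Q),\quad H_3=\mathcal N(P)\cap\mathcal R(Q),\quad H_4=\mathcal N(P)\cap\mathcal N(Q),$$ $$H_5=\overline{\mathcal R\big(PQ(I-P)\big)},\qquad H_6=\overline{\mathcal R\big((I-P)QP\big)}.$$ The pair $(m(Q),Q)$ is called harmonious if $H_5$ and $H_6$ are orthogonally complemented in $H$. (A submodule $M$ is orthogonally complemented if $H=M+M^\perp$; then $P_M$ denotes the projection of $H$ onto $M$.) **Theorem.** Let $Q\in\mathcal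 L(H)$ be an idempotent that is not a projection (i.e. $Q^2=Q\neq Q^*$), such that $(m(Q),Q)$ is harmonious. Then $H_2=H_3=\{0\}$, the submodules $H_1,H_4,H_5,H_6$ are orthogonally complemented in $H$, and the operator $$W:H\to H_1\oplus H_4\oplus H_5\oplus H_6,\qquad Wx=(P_{H_1}x,P_{H_4}x,P_{H_5}x,P_{H_6}x)^T,$$ is unitary. Moreover $$W\,m(Q)\,W^*=I_{H_1}\oplus 0_{H_4}\oplus I_{H_5}\oplus 0_{H_6},$$ and there are a unitary operator $U\in\mathcal L(H_5,H_6)$ and an operator $A\in\mathcal L(H_5)$ with $A\ge I_{H_5}$ and $\overline{\mathcal R(A-I_{H_5})}=H_5$ such that $$W\,Q\,W^*=I_{H_1}\oplus 0_{H_4}\oplus\widehat Q,\qquad \widehat Q=\begin{pmatrix}A & -A^{1/2}(A-I_{H_5})^{1/2}U^*\\ UA^{1/2}(A-I_{H_5})^{1/2} & U(I_{H_5}-A)U^*\end{pmatrix}\in\mathcal L(H_5\oplus H_6).$$ -/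

import Mathlib

open scoped WithCStarModule

noncomputable section

/-- `Adjointable 𝔄 H K` is the space `𝓛(H, K)` of adjointable operators between Hilbert
`𝔄`-modules: maps `T : H → K` for which there is `T* : K → H` with `⟪T x, y⟫ = ⟪x, T* y⟫`.
Such maps are automatically bounded, `ℂ`-linear and `𝔄`-linear, and `T*` is unique. -/
structure Adjointable (𝔄 H K : Type*)
    [NonUnitalCStarAlgebra 𝔄] [PartialOrder 𝔄] [StarOrderedRing 𝔄]
    [NormedAddCommGroup H] [NormedSpace ℂ H] [SMul 𝔄 H] [CStarModule 𝔄 H]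
    [NormedAddCommGroup K] [NormedSpace ℂ K] [SMul 𝔄 K] [CStarModule 𝔄 K] where
  /-- The operator itself. -/
  toCLM : H →L[ℂ] K
  /-- The adjoint operator. -/
  adjCLM : K →L[ℂ] H
  inner_adj : ∀ (x : H) (y : K), inner 𝔄 (toCLM x) y = inner 𝔄 x (adjCLM y)

section ModuleFacts

variable {𝔄 H : Type*} [NonUnitalCStarAlgebra 𝔄] [PartialOrder 𝔄] [StarOrderedRing 𝔄]
  [NormedAddCommGroup H] [NormedSpace ℂ H] [SMul 𝔄 H] [CStarModule 𝔄 H]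

set_option linter.unusedSectionVars false

variable (𝔄) in
theorem cstarModule_ext_right {x y : H} (h : ∀ z : H, inner 𝔄 z x = inner 𝔄 z y) : x = y := by
  have h1 : inner 𝔄 (x - y) (x - y) = 0 := by
    rw [CStarModule.inner_sub_right, h, sub_self]
  exact sub_eq_zero.mp (CStarModule.inner_self.mp h1)

variable (𝔄) in
theorem cstarModule_ext_left {x y : H} (h : ∀ z : H, inner 𝔄 x z = inner 𝔄 y z) : x = y := by
  refine cstarModule_ext_right 𝔄 fun z => ?_
  rw [← CStarModule.star_inner x z, ← CStarModule.star_inner y z, h]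

theorem cstarModule_smul_add (a : 𝔄) (x y : H) : a • (x + y) = a • x + a • y := by
  refine cstarModule_ext_right 𝔄 fun z => ?_
  simp [mul_add]

theorem cstarModule_smul_zero (a : 𝔄) : a • (0 : H) = 0 := by
  refine cstarModule_ext_right 𝔄 fun z => ?_
  simp

theorem cstarModule_norm_smul_le (a : 𝔄) (x : H) : ‖a • x‖ ≤ ‖a‖ * ‖x‖ := by
  refine abs_le_of_sq_le_sq' ?_ (by positivity) |>.2
  rw [CStarModule.norm_sq_eq 𝔄, CStarModule.inner_op_smul_right, CStarModule.inner_op_smul_left,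
    mul_pow, CStarModule.norm_sq_eq (E := H) 𝔄]
  calc ‖a * (inner 𝔄 x x * star a)‖ ≤ ‖a‖ * (‖inner 𝔄 x x‖ * ‖star a‖) :=
        (norm_mul_le _ _).trans (by gcongr; exact norm_mul_le _ _)
    _ = ‖a‖ ^ 2 * ‖inner 𝔄 x x‖ := by rw [norm_star]; ring

theorem cstarModule_continuous_smul (a : 𝔄) : Continuous fun x : H => a • x := by
  let f : H →+ H :=
    { toFun := fun x => a • x
      map_zero' := cstarModule_smul_zero a
      map_add' := cstarModule_smul_add a }
  exact AddMonoidHomClass.continuous_of_bound f ‖a‖ (cstarModule_norm_smul_le a)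

end ModuleFacts

namespace Adjointable

variable {𝔄 H K L : Type*} [NonUnitalCStarAlgebra 𝔄] [PartialOrder 𝔄] [StarOrderedRing 𝔄]
  [NormedAddCommGroup H] [NormedSpace ℂ H] [SMul 𝔄 H] [CStarModule 𝔄 H]
  [NormedAddCommGroup K] [NormedSpace ℂ K] [SMul 𝔄 K] [CStarModule 𝔄 K]
  [NormedAddCommGroup L] [NormedSpace ℂ L] [SMul 𝔄 L] [CStarModule 𝔄 L]

instance : CoeFun (Adjointable 𝔄 H K) fun _ => H → K := ⟨fun T => T.toCLM⟩

theorem toCLM_injective :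
    Function.Injective (toCLM : Adjointable 𝔄 H K → H →L[ℂ] K) := by
  rintro ⟨T, T', hT⟩ ⟨S, S', hS⟩ (rfl : T = S)
  have : T' = S' := by
    ext y
    refine cstarModule_ext_right 𝔄 fun z => ?_
    rw [← hT, ← hS]
  subst this
  rfl

@[ext]
theorem ext {S T : Adjointable 𝔄 H K} (h : ∀ x, S x = T x) : S = T :=
  toCLM_injective (ContinuousLinearMap.ext h)

theorem map_op_smul (T : Adjointable 𝔄 H K) (a : 𝔄) (x : H) : T (a • x) = a • T x := by
  refine cstarModule_ext_left 𝔄 fun z => ?_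
  rw [T.inner_adj, CStarModule.inner_op_smul_left, CStarModule.inner_op_smul_left, T.inner_adj]

/-- The adjoint `T* ∈ 𝓛(K, H)` of `T ∈ 𝓛(H, K)`. -/
def adjoint (T : Adjointable 𝔄 H K) : Adjointable 𝔄 K H where
  toCLM := T.adjCLM
  adjCLM := T.toCLM
  inner_adj x y := by
    rw [← CStarModule.star_inner, ← T.inner_adj, CStarModule.star_inner]

/-- Composition of adjointable operators. -/
def comp (S : Adjointable 𝔄 K L) (T : Adjointable 𝔄 H K) : Adjointable 𝔄 H L where
  toCLM := S.toCLM.comp T.toCLM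
  adjCLM := T.adjCLM.comp S.adjCLM
  inner_adj x y := by
    rw [ContinuousLinearMap.comp_apply, ContinuousLinearMap.comp_apply, S.inner_adj, T.inner_adj]

variable (𝔄 H) in
/-- The identity operator. -/
def id : Adjointable 𝔄 H H where
  toCLM := ContinuousLinearMap.id ℂ H
  adjCLM := ContinuousLinearMap.id ℂ H
  inner_adj _ _ := rfl

instance : Zero (Adjointable 𝔄 H K) where
  zero :=
    { toCLM := 0
      adjCLM := 0
      inner_adj := fun x y => by simp }

instance : Add (Adjointable 𝔄 H K) where
  add S T :=
    { toCLM := S.toCLM + T.toCLM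
      adjCLM := S.adjCLM + T.adjCLM
      inner_adj := fun x y => by simp [S.inner_adj, T.inner_adj] }

instance : Neg (Adjointable 𝔄 H K) where
  neg S :=
    { toCLM := -S.toCLM
      adjCLM := -S.adjCLM
      inner_adj := fun x y => by simp [S.inner_adj] }

instance : Sub (Adjointable 𝔄 H K) where
  sub S T :=
    { toCLM := S.toCLM - T.toCLM
      adjCLM := S.adjCLM - T.adjCLM
      inner_adj := fun x y => by simp [S.inner_adj, T.inner_adj] }

instance : SMul ℂ (Adjointable 𝔄 H K) where
  smul c S :=
    { toCLM := c • S.toCLM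
      adjCLM := (starRingEnd ℂ c) • S.adjCLM
      inner_adj := fun x y => by simp [S.inner_adj] }

instance : SMul ℕ (Adjointable 𝔄 H K) where
  smul n S :=
    { toCLM := n • S.toCLM
      adjCLM := n • S.adjCLM
      inner_adj := fun x y => by
        simp only [← Nat.cast_smul_eq_nsmul ℂ, smul_apply]
        simp [S.inner_adj] }

instance : SMul ℤ (Adjointable 𝔄 H K) where
  smul n S :=
    { toCLM := n • S.toCLM
      adjCLM := n • S.adjCLM
      inner_adj := fun x y => by
        simp only [← Int.cast_smul_eq_zsmul ℂ, smul_apply]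
        simp [S.inner_adj] }

instance : AddCommGroup (Adjointable 𝔄 H K) :=
  toCLM_injective.addCommGroup (toCLM : Adjointable 𝔄 H K → H →L[ℂ] K)
    rfl (fun _ _ => rfl) (fun _ => rfl) (fun _ _ => rfl) (fun _ _ => rfl) (fun _ _ => rfl)

/-! ### The unital C⋆-algebra `𝓛(H)` -/

instance : One (Adjointable 𝔄 H H) := ⟨id 𝔄 H⟩

instance : Mul (Adjointable 𝔄 H H) := ⟨comp⟩

instance : Star (Adjointable 𝔄 H H) := ⟨adjoint⟩

instance : Ring (Adjointable 𝔄 H H) :=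
  { (inferInstance : AddCommGroup (Adjointable 𝔄 H H)) with
    mul := (· * ·)
    one := 1
    left_distrib := fun S _ _ => ext fun _ => map_add S.toCLM _ _
    right_distrib := fun _ _ _ => ext fun _ => rfl
    zero_mul := fun _ => ext fun _ => rfl
    mul_zero := fun S => ext fun _ => map_zero S.toCLM
    mul_assoc := fun _ _ _ => rfl
    one_mul := fun _ => rfl
    mul_one := fun _ => rfl }

instance : StarRing (Adjointable 𝔄 H H) where
  star_involutive _ := rfl
  star_mul _ _ := rfl
  star_add _ _ := rfl

instance : Module ℂ (Adjointable 𝔄 H H) :=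
  toCLM_injective.module ℂ
    ({ toFun := toCLM, map_zero' := rfl, map_add' := fun _ _ => rfl } :
      Adjointable 𝔄 H H →+ (H →L[ℂ] H)) (fun _ _ => rfl)

instance : Algebra ℂ (Adjointable 𝔄 H H) :=
  Algebra.ofModule (fun _ _ _ => ext fun _ => rfl) (fun c S T => ext fun x => map_smul S.toCLM c (T x))

/-- The embedding of `𝓛(H)` into the bounded operators on `H`, forgetting the adjoint. -/
def toCLMHom : Adjointable 𝔄 H H →ₐ[ℂ] (H →L[ℂ] H) where
  toFun := toCLM
  map_one' := rfl
  map_mul' _ _ := rfl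
  map_zero' := rfl
  map_add' _ _ := rfl
  commutes' _ := rfl

/-- The norm of `𝓛(H)` is the operator norm. -/
instance : NormedRing (Adjointable 𝔄 H H) :=
  NormedRing.induced (Adjointable 𝔄 H H) (H →L[ℂ] H) toCLMHom toCLM_injective

theorem norm_eq (T : Adjointable 𝔄 H H) : ‖T‖ = ‖T.toCLM‖ := rfl

instance : NormedAlgebra ℂ (Adjointable 𝔄 H H) where
  norm_smul_le c T := (norm_smul c T.toCLM).le

instance : StarModule ℂ (Adjointable 𝔄 H H) where
  star_smul _ _ := ext fun _ => rfl

theorem norm_adjCLM_le (T : Adjointable 𝔄 H H) : ‖T.adjCLM‖ ≤ ‖T.toCLM‖ := by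
  refine T.adjCLM.opNorm_le_bound (norm_nonneg _) fun y => ?_
  rcases eq_or_ne (T.adjCLM y) 0 with h | h
  · rw [h, norm_zero]; positivity
  · refine le_of_mul_le_mul_right ?_ (norm_pos_iff.mpr h)
    calc ‖T.adjCLM y‖ * ‖T.adjCLM y‖ = ‖inner 𝔄 (T.adjCLM y) (T.adjCLM y)‖ := by
          rw [← CStarModule.norm_sq_eq 𝔄, sq]
      _ = ‖inner 𝔄 (T.toCLM (T.adjCLM y)) y‖ := by rw [T.inner_adj]
      _ ≤ ‖T.toCLM (T.adjCLM y)‖ * ‖y‖ := CStarModule.norm_inner_le H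
      _ ≤ ‖T.toCLM‖ * ‖T.adjCLM y‖ * ‖y‖ := by gcongr; exact T.toCLM.le_opNorm _
      _ = ‖T.toCLM‖ * ‖y‖ * ‖T.adjCLM y‖ := by ring

instance : CStarRing (Adjointable 𝔄 H H) where
  norm_mul_self_le T := by
    have h : ‖T.toCLM‖ ≤ √‖star T * T‖ := by
      refine T.toCLM.opNorm_le_bound (Real.sqrt_nonneg _) fun x => ?_
      refine abs_le_of_sq_le_sq' ?_ (by positivity) |>.2
      rw [mul_pow, Real.sq_sqrt (norm_nonneg _)]
      calc ‖T.toCLM x‖ ^ 2 = ‖inner 𝔄 (T.toCLM x) (T.toCLM x)‖ := CStarModule.norm_sq_eq 𝔄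
        _ = ‖inner 𝔄 x ((star T * T).toCLM x)‖ := by rw [T.inner_adj]; rfl
        _ ≤ ‖x‖ * ‖(star T * T).toCLM x‖ := CStarModule.norm_inner_le H
        _ ≤ ‖x‖ * (‖star T * T‖ * ‖x‖) := by
            gcongr; exact (star T * T).toCLM.le_opNorm x
        _ = ‖star T * T‖ * ‖x‖ ^ 2 := by ring
    calc ‖T‖ * ‖T‖ ≤ √‖star T * T‖ * √‖star T * T‖ := by
          rw [norm_eq]; gcongr
      _ = ‖star T * T‖ := Real.mul_self_sqrt (norm_nonneg _)

instance [CompleteSpace H] : CompleteSpace (Adjointable 𝔄 H H) := by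
  refine Metric.complete_of_cauchySeq_tendsto fun u hu => ?_
  have h1 : CauchySeq fun n => (u n).toCLM := by
    rw [Metric.cauchySeq_iff] at hu ⊢
    intro ε hε
    obtain ⟨N, hN⟩ := hu ε hε
    exact ⟨N, fun m hm n hn => hN m hm n hn⟩
  have h2 : CauchySeq fun n => (u n).adjCLM := by
    rw [Metric.cauchySeq_iff] at hu ⊢
    intro ε hε
    obtain ⟨N, hN⟩ := hu ε hε
    refine ⟨N, fun m hm n hn => lt_of_le_of_lt ?_ (hN m hm n hn)⟩
    rw [dist_eq_norm, dist_eq_norm]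
    exact norm_adjCLM_le (u m - u n)
  obtain ⟨T, hT⟩ := cauchySeq_tendsto_of_complete h1
  obtain ⟨S, hS⟩ := cauchySeq_tendsto_of_complete h2
  have hTS : ∀ x y, inner 𝔄 (T x) y = inner 𝔄 x (S y) := by
    intro x y
    have a1 : Filter.Tendsto (fun n => (u n).toCLM x) Filter.atTop (nhds (T x)) :=
      ((ContinuousLinearMap.apply ℂ H x).continuous.tendsto T).comp hT
    have a2 : Filter.Tendsto (fun n => (u n).adjCLM y) Filter.atTop (nhds (S y)) :=
      ((ContinuousLinearMap.apply ℂ H y).continuous.tendsto S).comp hS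
    have b1 : Filter.Tendsto (fun n => inner 𝔄 ((u n).toCLM x) y) Filter.atTop
        (nhds (inner 𝔄 (T x) y)) :=
      ((CStarModule.continuous_inner (A := 𝔄) (E := H)).tendsto (T x, y)).comp
        (a1.prodMk_nhds tendsto_const_nhds)
    have b2 : Filter.Tendsto (fun n => inner 𝔄 x ((u n).adjCLM y)) Filter.atTop
        (nhds (inner 𝔄 x (S y))) :=
      ((CStarModule.continuous_inner (A := 𝔄) (E := H)).tendsto (x, S y)).comp
        (tendsto_const_nhds.prodMk_nhds a2)
    refine tendsto_nhds_unique b1 (b2.congr fun n => ?_)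
    rw [(u n).inner_adj]
  refine ⟨⟨T, S, hTS⟩, ?_⟩
  rw [tendsto_iff_dist_tendsto_zero] at hT ⊢
  exact hT

instance [CompleteSpace H] : CStarAlgebra (Adjointable 𝔄 H H) where

/-- `𝓛(H)` carries the order of a C⋆-algebra: `S ≤ T` when `T - S` is positive. -/
instance [CompleteSpace H] : PartialOrder (Adjointable 𝔄 H H) :=
  CStarAlgebra.spectralOrder _

instance [CompleteSpace H] : StarOrderedRing (Adjointable 𝔄 H H) :=
  CStarAlgebra.spectralOrderedRing _

/-- A unitary operator `U ∈ 𝓛(H, K)`: `U* U = I` and `U U* = I`. -/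
def IsUnitary (U : Adjointable 𝔄 H K) : Prop :=
  U.adjoint.comp U = id 𝔄 H ∧ U.comp U.adjoint = id 𝔄 K

/-! ### Direct sums and block matrices -/

theorem norm_fst_le (x : C⋆ᵐᵒᵈ(𝔄, H × K)) : ‖x.1‖ ≤ ‖x‖ :=
  (le_max_left _ _).trans (WithCStarModule.max_le_prod_norm x)

theorem norm_snd_le (x : C⋆ᵐᵒᵈ(𝔄, H × K)) : ‖x.2‖ ≤ ‖x‖ :=
  (le_max_right _ _).trans (WithCStarModule.max_le_prod_norm x)

variable (𝔄 H K) in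
/-- The inclusion `x ↦ (x, 0)` of `H` into `H ⊕ K`; its adjoint is `(x, y) ↦ x`. -/
def inl : Adjointable 𝔄 H C⋆ᵐᵒᵈ(𝔄, H × K) where
  toCLM := LinearMap.mkContinuous
    { toFun := fun x => (WithCStarModule.equiv 𝔄 (H × K)).symm (x, 0)
      map_add' := fun x y => by rw [← WithCStarModule.equiv_symm_add]; simp
      map_smul' := fun c x => by rw [← WithCStarModule.equiv_symm_smul]; simp }
    1 (fun x => by
      refine (WithCStarModule.prod_norm_le_norm_add _).trans ?_
      simp)
  adjCLM := LinearMap.mkContinuous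
    { toFun := fun x => x.1
      map_add' := fun _ _ => rfl
      map_smul' := fun _ _ => rfl }
    1 (fun x => by rw [one_mul]; exact norm_fst_le x)
  inner_adj x y := by simp [WithCStarModule.prod_inner]

variable (𝔄 H K) in
/-- The inclusion `y ↦ (0, y)` of `K` into `H ⊕ K`; its adjoint is `(x, y) ↦ y`. -/
def inr : Adjointable 𝔄 K C⋆ᵐᵒᵈ(𝔄, H × K) where
  toCLM := LinearMap.mkContinuous
    { toFun := fun y => (WithCStarModule.equiv 𝔄 (H × K)).symm (0, y)
      map_add' := fun x y => by rw [← WithCStarModule.equiv_symm_add]; simp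
      map_smul' := fun c x => by rw [← WithCStarModule.equiv_symm_smul]; simp }
    1 (fun x => by
      refine (WithCStarModule.prod_norm_le_norm_add _).trans ?_
      simp)
  adjCLM := LinearMap.mkContinuous
    { toFun := fun x => x.2
      map_add' := fun _ _ => rfl
      map_smul' := fun _ _ => rfl }
    1 (fun x => by rw [one_mul]; exact norm_snd_le x)
  inner_adj x y := by simp [WithCStarModule.prod_inner]

/-- The operator `x ↦ (S x, T x)` from `L` to `H ⊕ K`. -/
def column (S : Adjointable 𝔄 L H) (T : Adjointable 𝔄 L K) :
    Adjointable 𝔄 L C⋆ᵐᵒᵈ(𝔄, H × K) :=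
  (inl 𝔄 H K).comp S + (inr 𝔄 H K).comp T

/-- The operator on `H ⊕ K` with block matrix `[[a, b], [c, d]]`, that is,
`(x, y) ↦ (a x + b y, c x + d y)`. -/
def block (a : Adjointable 𝔄 H H) (b : Adjointable 𝔄 K H)
    (c : Adjointable 𝔄 H K) (d : Adjointable 𝔄 K K) :
    Adjointable 𝔄 C⋆ᵐᵒᵈ(𝔄, H × K) C⋆ᵐᵒᵈ(𝔄, H × K) :=
  column (a.comp (inl 𝔄 H K).adjoint + b.comp (inr 𝔄 H K).adjoint)
    (c.comp (inl 𝔄 H K).adjoint + d.comp (inr 𝔄 H K).adjoint)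

/-- The direct sum `S ⊕ T` on `H ⊕ K`, that is, `(x, y) ↦ (S x, T y)`. -/
def directSum (S : Adjointable 𝔄 H H) (T : Adjointable 𝔄 K K) :
    Adjointable 𝔄 C⋆ᵐᵒᵈ(𝔄, H × K) C⋆ᵐᵒᵈ(𝔄, H × K) :=
  block S 0 0 T

end Adjointable

/-- A (not necessarily closed) submodule of a Hilbert `𝔄`-module. -/
structure CStarSubmodule (𝔄 H : Type*)
    [NonUnitalCStarAlgebra 𝔄] [PartialOrder 𝔄] [StarOrderedRing 𝔄]
    [NormedAddCommGroup H] [NormedSpace ℂ H] [SMul 𝔄 H] [CStarModule 𝔄 H]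
    extends Submodule ℂ H where
  op_smul_mem' : ∀ (a : 𝔄) {x : H}, x ∈ carrier → a • x ∈ carrier

namespace CStarSubmodule

variable {𝔄 H K : Type*} [NonUnitalCStarAlgebra 𝔄] [PartialOrder 𝔄] [StarOrderedRing 𝔄]
  [NormedAddCommGroup H] [NormedSpace ℂ H] [SMul 𝔄 H] [CStarModule 𝔄 H]
  [NormedAddCommGroup K] [NormedSpace ℂ K] [SMul 𝔄 K] [CStarModule 𝔄 K]

instance : CoeSort (CStarSubmodule 𝔄 H) (Type _) := ⟨fun M => M.toSubmodule⟩

instance (M : CStarSubmodule 𝔄 H) : SMul 𝔄 M.toSubmodule where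
  smul a x := ⟨a • (x : H), M.op_smul_mem' a x.2⟩

/-- A submodule carries the restricted inner product. -/
instance (M : CStarSubmodule 𝔄 H) : CStarModule 𝔄 M.toSubmodule where
  inner x y := inner 𝔄 (x : H) (y : H)
  inner_add_right := CStarModule.inner_add_right
  inner_self_nonneg := CStarModule.inner_self_nonneg
  inner_self {x} := by rw [CStarModule.inner_self, Submodule.coe_eq_zero]
  inner_op_smul_right := CStarModule.inner_op_smul_right
  inner_smul_right_complex := CStarModule.inner_smul_right_complex
  star_inner _ _ := CStarModule.star_inner _ _
  norm_eq_sqrt_norm_inner_self x := CStarModule.norm_eq_sqrt_norm_inner_self (x : H)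

instance : Bot (CStarSubmodule 𝔄 H) where
  bot :=
    { (⊥ : Submodule ℂ H) with
      op_smul_mem' := fun a x hx => by
        have hx0 : x = 0 := hx
        subst hx0
        exact cstarModule_smul_zero a }

instance : Min (CStarSubmodule 𝔄 H) where
  min M N :=
    { M.toSubmodule ⊓ N.toSubmodule with
      op_smul_mem' := fun a _ hx => ⟨M.op_smul_mem' a hx.1, N.op_smul_mem' a hx.2⟩ }

/-- The range of an adjointable operator. -/
def range (T : Adjointable 𝔄 H K) : CStarSubmodule 𝔄 K where
  toSubmodule := LinearMap.range (T.toCLM : H →ₗ[ℂ] K)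
  op_smul_mem' := by
    rintro a _ ⟨x, rfl⟩
    exact ⟨a • x, T.map_op_smul a x⟩

/-- The null space of an adjointable operator. -/
def ker (T : Adjointable 𝔄 H K) : CStarSubmodule 𝔄 H where
  toSubmodule := LinearMap.ker (T.toCLM : H →ₗ[ℂ] K)
  op_smul_mem' a x hx := by
    have hx' : T x = 0 := hx
    change T (a • x) = 0
    rw [T.map_op_smul, hx', cstarModule_smul_zero]

/-- The closure of a submodule. -/
def closure (M : CStarSubmodule 𝔄 H) : CStarSubmodule 𝔄 H where
  toSubmodule := M.toSubmodule.topologicalClosure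
  op_smul_mem' a _ hx :=
    map_mem_closure (cstarModule_continuous_smul a) hx fun _ hy => M.op_smul_mem' a hy

instance [CompleteSpace H] (M : CStarSubmodule 𝔄 H) : CompleteSpace M.closure.toSubmodule :=
  M.toSubmodule.isClosed_topologicalClosure.completeSpace_coe

/-- The orthogonal complement `M^⊥ = {x | ⟪x, y⟫ = 0 for every y ∈ M}`. -/
def orthogonal (M : CStarSubmodule 𝔄 H) : CStarSubmodule 𝔄 H where
  carrier := {x | ∀ y ∈ M.toSubmodule, inner 𝔄 x y = 0}
  add_mem' hx hx' y hy := by rw [CStarModule.inner_add_left, hx y hy, hx' y hy, add_zero]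
  zero_mem' y _ := CStarModule.inner_zero_left
  smul_mem' c x hx y hy := by rw [CStarModule.inner_smul_left_complex, hx y hy, smul_zero]
  op_smul_mem' a x hx y hy := by rw [CStarModule.inner_op_smul_left, hx y hy, zero_mul]

/-- `M` is orthogonally complemented in `H`: `H = M + M^⊥` (this forces `M` to be closed). -/
def IsOrthogonallyComplemented (M : CStarSubmodule 𝔄 H) : Prop :=
  M.toSubmodule ⊔ M.orthogonal.toSubmodule = ⊤

theorem IsOrthogonallyComplemented.exists_decomp {M : CStarSubmodule 𝔄 H}
    (h : M.IsOrthogonallyComplemented) (x : H) :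
    ∃ m : M.toSubmodule, x - m ∈ M.orthogonal.toSubmodule := by
  obtain ⟨m, hm, n, hn, rfl⟩ := Submodule.mem_sup.mp (h ▸ Submodule.mem_top : x ∈ _)
  exact ⟨⟨m, hm⟩, by simpa using hn⟩

theorem decomp_unique {M : CStarSubmodule 𝔄 H} {x : H} {m n : M.toSubmodule}
    (hm : x - m ∈ M.orthogonal.toSubmodule) (hn : x - n ∈ M.orthogonal.toSubmodule) : m = n := by
  have h : (m : H) - n ∈ M.orthogonal.toSubmodule := by
    have := M.orthogonal.toSubmodule.sub_mem hn hm
    rwa [sub_sub_sub_cancel_left] at this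
  have h0 : inner 𝔄 ((m : H) - n) ((m : H) - n) = 0 := h _ (M.toSubmodule.sub_mem m.2 n.2)
  exact Subtype.ext (sub_eq_zero.mp (CStarModule.inner_self.mp h0))

/-- For orthogonally complemented `M`, the operator `P_M ∈ 𝓛(H, M)` sending `x` to the unique
`m ∈ M` with `x - m ∈ M^⊥`. -/
def IsOrthogonallyComplemented.projection {M : CStarSubmodule 𝔄 H}
    (h : M.IsOrthogonallyComplemented) : Adjointable 𝔄 H M where
  toCLM := LinearMap.mkContinuous
    { toFun := fun x => (h.exists_decomp x).choose
      map_add' := fun x y => by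
        refine decomp_unique (h.exists_decomp (x + y)).choose_spec ?_
        have := M.orthogonal.toSubmodule.add_mem (h.exists_decomp x).choose_spec
          (h.exists_decomp y).choose_spec
        rwa [sub_add_sub_comm] at this
      map_smul' := fun c x => by
        refine decomp_unique (h.exists_decomp (c • x)).choose_spec ?_
        have := M.orthogonal.toSubmodule.smul_mem c (h.exists_decomp x).choose_spec
        rwa [smul_sub] at this }
    1 (fun x => by
      have hs := (h.exists_decomp x).choose_spec
      set m := (h.exists_decomp x).choose with hm
      change ‖m‖ ≤ 1 * ‖x‖
      rw [one_mul]
      have h1 : inner 𝔄 (x - m) (m : H) = 0 := hs _ m.2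
      have h2 : inner 𝔄 x (m : H) = inner 𝔄 (m : H) (m : H) := by
        rwa [CStarModule.inner_sub_left, sub_eq_zero] at h1
      rcases eq_or_ne m 0 with h0 | h0
      · rw [h0, norm_zero]; positivity
      · refine le_of_mul_le_mul_right ?_ (norm_pos_iff.mpr h0)
        calc ‖m‖ * ‖m‖ = ‖inner 𝔄 (m : H) (m : H)‖ := by
              rw [← CStarModule.norm_sq_eq 𝔄, sq]; rfl
          _ = ‖inner 𝔄 x (m : H)‖ := by rw [h2]
          _ ≤ ‖x‖ * ‖m‖ := CStarModule.norm_inner_le H)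
  adjCLM := M.toSubmodule.subtypeL
  inner_adj x y := by
    have h1 : inner 𝔄 (x - ((h.exists_decomp x).choose : H)) (y : H) = 0 :=
      (h.exists_decomp x).choose_spec _ y.2
    rw [CStarModule.inner_sub_left, sub_eq_zero] at h1
    exact h1.symm

open Classical in
/-- The projection `P_M`, viewed in `𝓛(H, M)`. It has the default value `0` if `M` is not
orthogonally complemented. -/
def projection (M : CStarSubmodule 𝔄 H) : Adjointable 𝔄 H M :=
  if h : M.IsOrthogonallyComplemented then h.projection else 0

end CStarSubmodule

section Pairs

variable {𝔄 H : Type*} [NonUnitalCStarAlgebra 𝔄] [PartialOrder 𝔄] [StarOrderedRing 𝔄]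
  [NormedAddCommGroup H] [NormedSpace ℂ H] [SMul 𝔄 H] [CStarModule 𝔄 H]

/-- `X` is the Moore–Penrose inverse of `T`. -/
structure IsMoorePenroseInverse (T X : Adjointable 𝔄 H H) : Prop where
  mul_mul_left : T * X * T = T
  mul_mul_right : X * T * X = X
  left_selfAdjoint : star (T * X) = T * X
  right_selfAdjoint : star (X * T) = X * T

open Classical in
/-- The Moore–Penrose inverse `T^†`, with the default value `0` if it does not exist. -/
def moorePenroseInverse (T : Adjointable 𝔄 H H) : Adjointable 𝔄 H H :=
  if h : ∃ X, IsMoorePenroseInverse T X then h.choose else 0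

/-- The matched projection
`m(Q) = ½ (|Q*| + Q*) |Q*|^† (|Q*| + I)⁻¹ (|Q*| + Q)` of an idempotent `Q`,
where `|Q*| = (Q Q*)^{1/2}`. -/
def matchedProjection [CompleteSpace H] (Q : Adjointable 𝔄 H H) : Adjointable 𝔄 H H :=
  (1 / 2 : ℂ) • ((CFC.abs (star Q) + star Q) * moorePenroseInverse (CFC.abs (star Q)) *
    Ring.inverse (CFC.abs (star Q) + 1) * (CFC.abs (star Q) + Q))

/-- `H₁ = 𝓡(P) ∩ 𝓡(Q)`. -/
abbrev halmosH1 (P Q : Adjointable 𝔄 H H) : CStarSubmodule 𝔄 H :=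
  CStarSubmodule.range P ⊓ CStarSubmodule.range Q

/-- `H₂ = 𝓡(P) ∩ 𝓝(Q)`. -/
abbrev halmosH2 (P Q : Adjointable 𝔄 H H) : CStarSubmodule 𝔄 H :=
  CStarSubmodule.range P ⊓ CStarSubmodule.ker Q

/-- `H₃ = 𝓝(P) ∩ 𝓡(Q)`. -/
abbrev halmosH3 (P Q : Adjointable 𝔄 H H) : CStarSubmodule 𝔄 H :=
  CStarSubmodule.ker P ⊓ CStarSubmodule.range Q

/-- `H₄ = 𝓝(P) ∩ 𝓝(Q)`. -/
abbrev halmosH4 (P Q : Adjointable 𝔄 H H) : CStarSubmodule 𝔄 H :=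
  CStarSubmodule.ker P ⊓ CStarSubmodule.ker Q

/-- `H₅` is the closure of the range of `P Q (I - P)`. -/
abbrev halmosH5 (P Q : Adjointable 𝔄 H H) : CStarSubmodule 𝔄 H :=
  (CStarSubmodule.range (P * Q * (1 - P))).closure

/-- `H₆` is the closure of the range of `(I - P) Q P`. -/
abbrev halmosH6 (P Q : Adjointable 𝔄 H H) : CStarSubmodule 𝔄 H :=
  (CStarSubmodule.range ((1 - P) * Q * P)).closure

/-- The condition for a pair `(P, Q)` to be harmonious: `H₅` and `H₆` are orthogonally
complemented in `H`. -/
def IsHarmonious (P Q : Adjointable 𝔄 H H) : Prop :=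
  (halmosH5 P Q).IsOrthogonallyComplemented ∧ (halmosH6 P Q).IsOrthogonallyComplemented

/-- The Hilbert `𝔄`-module `H₁ ⊕ H₄ ⊕ H₅ ⊕ H₆`. -/
abbrev HalmosSum (P Q : Adjointable 𝔄 H H) : Type _ :=
  C⋆ᵐᵒᵈ(𝔄, halmosH1 P Q × C⋆ᵐᵒᵈ(𝔄, halmosH4 P Q × C⋆ᵐᵒᵈ(𝔄, halmosH5 P Q × halmosH6 P Q)))

/-- The operator `U_{P,Q} : H → H₁ ⊕ H₄ ⊕ H₅ ⊕ H₆`,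
`x ↦ (P_{H₁} x, P_{H₄} x, P_{H₅} x, P_{H₆} x)`. -/
def halmosUnitary (P Q : Adjointable 𝔄 H H) : Adjointable 𝔄 H (HalmosSum P Q) :=
  Adjointable.column (halmosH1 P Q).projection
    (Adjointable.column (halmosH4 P Q).projection
      (Adjointable.column (halmosH5 P Q).projection (halmosH6 P Q).projection))

end Pairs

end

/-! Write `T = |Q*|`, `S = T^†`, `K = (T + 1)⁻¹`, `P = m(Q)` and `J = 2P - 1`. Everything rests on
three facts about `P` besides its being a projection: `JQ` is self-adjoint, `P ≤ PQP`, and `(1 -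
P)Q(1 - P) ≤ 0`. The formula for `P` gives `2QP = T + Q` and `JQ = Q* S Q ≥ 0`; compressing the
latter by `1 - P` gives the last fact. The second comes down to `TS ≤ T`, where `TS` is the range
projection of `Q` (`matched_projection_properties`). From there only `IsMatchedPair` is used.

Relative to `P`, self-adjointness of `JQ` says that the two off-diagonal corners of `Q` are `b` and
`-b*`. The two inequalities make `1 + (PQP - P)` and `1 - (1 - P)Q(1 - P)` invertible; this kills
`H₂` and `H₃`, and shows that `Q` is the identity on vectors of `𝓡(P)` that it keeps in `𝓡(P)`, and
zero on vectors that it sends into `𝓝(P)`. As `b` vanishes on `𝓡(P) ⊖ H₅` and `b*` on `𝓝(P) ⊖ H₆`,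
these complements are `H₁` and `H₄`. So the four projections are orthogonal with sum `1`, and `W` is
unitary.

On `H₅ ⊕ H₆`, which `Q` leaves invariant, `Q` has the matrix `[[A, -B*], [B, D]]` with `A ≥ 1`, and
`Q² = Q` yields `B*B = (A - 1)A` and `DB = B(1 - A)`. Put `C = A^{1/2}(A - 1)^{1/2}`, so that `C² =
B*B`. Both `B` and `C` have dense range, hence `Cx ↦ Bx` extends to a unitary `U` with `B = UC`, and
the second relation forces `D = U(1 - A)U*`. Density has to be proved by approximation
(`Adjointable.star_apply_mem_closure_range`), since in a Hilbert module a trivial orthogonal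
complement does not imply density. -/

noncomputable section

/-! ### Idempotents and the matched projection in a C⋆-algebra -/

section CStarAlgebraFacts

theorem mul_eq_zero_of_mul_conjugate_eq_zero {𝓐 : Type*} [CStarAlgebra 𝓐] {T e : 𝓐}
    (hT : IsSelfAdjoint T) (he : e * (T * T) * star e = 0) : e * T = 0 := by
  rw [← CStarRing.mul_star_self_eq_zero_iff, star_mul, hT.star_eq]
  simpa [mul_assoc] using he

variable {𝓐 : Type*} [CStarAlgebra 𝓐] [PartialOrder 𝓐] [StarOrderedRing 𝓐]

/-- The modulus of the adjoint of an idempotent has a positive Moore–Penrose inverse. -/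
theorem exists_inverse_abs_star_of_isIdempotentElem {Q : 𝓐} (hQ : IsIdempotentElem Q) :
    ∃ S : 𝓐, 0 ≤ S ∧ Commute (CFC.abs (star Q)) S ∧
      CFC.abs (star Q) * S * CFC.abs (star Q) = CFC.abs (star Q) ∧
      S * CFC.abs (star Q) * S = S ∧
      CFC.abs (star Q) * S * Q = Q ∧ Q * (CFC.abs (star Q) * S) = CFC.abs (star Q) * S := by
  set T := CFC.abs (star Q)
  have hT0 : 0 ≤ T := CFC.abs_nonneg _
  have hTT : T * T = Q * star Q := by simpa using CFC.abs_mul_abs (star Q)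
  have hQQ : Q * Q = Q := hQ
  have hQQ' : star Q * star Q = star Q := by rw [← star_mul, hQQ]
  -- `N ≥ 1` is invertible, and `NQ = QQ*Q = QN`, so its inverse `V` commutes with `Q` and `T`. It
  -- turns `QQ*` into the range projection of `Q`.
  set N : 𝓐 := 1 + star (Q - star Q) * (Q - star Q) with hN
  have hN1 : N = 1 - Q - star Q + Q * star Q + star Q * Q := by
    rw [hN, star_sub, star_star, sub_mul, mul_sub, mul_sub, hQQ, hQQ']
    abel
  have hNpos : IsStrictlyPositive N :=
    isStrictlyPositive_one.add_nonneg (star_mul_self_nonneg _)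
  obtain ⟨u, hu⟩ := hNpos.isUnit
  have hNsa : star N = N := (IsSelfAdjoint.of_nonneg hNpos.nonneg).star_eq
  have hNQ : Commute N Q := by
    rw [Commute, SemiconjBy, hN1]
    simp only [add_mul, sub_mul, mul_add, mul_sub, one_mul, mul_one, mul_assoc, hQQ]
    simp only [← mul_assoc, hQQ]
    abel
  have hNQ' : Commute N (star Q) := by
    have := hNQ.star_star
    rwa [hNsa] at this
  have hNT : Commute N T := (hNQ'.symm.cfcAbs_left (hNsa.symm ▸ hNQ'.symm)).symm
  set V : 𝓐 := ((u⁻¹ : 𝓐ˣ) : 𝓐) with hV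
  have hVN : V * N = 1 := by rw [← hu]; simp [hV]
  have hNV : N * V = 1 := by rw [← hu]; simp [hV]
  have hVT : Commute V T := by rw [← hu] at hNT; exact hNT.units_inv_left
  have hVQ : Commute V Q := by rw [← hu] at hNQ; exact hNQ.units_inv_left
  have hV0 : 0 ≤ V := by
    have h := star_left_conjugate_nonneg hNpos.nonneg V
    have hVs : star V = V := by
      have h1 : star V * N = 1 := by
        have := congrArg star hNV
        rwa [star_mul, star_one, hNsa] at this
      calc star V = star V * (N * V) := by rw [hNV, mul_one]
        _ = V := by rw [← mul_assoc, h1, one_mul]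
    rwa [hVs, hVN, one_mul] at h
  have hQsN : Q * star Q * Q = Q * N := by
    rw [hN1]
    simp only [mul_add, mul_sub, mul_one, ← mul_assoc, hQQ]
    abel
  -- With `S = VT`, the product `TS` is `R = QQ*V`, which is self-adjoint and fixes `Q` from the
  -- left.
  have hR : T * (V * T) = Q * star Q * V := by
    rw [hVT.eq, ← mul_assoc, hTT]
  have hRQ : Q * star Q * V * Q = Q := by
    rw [mul_assoc, hVQ.eq, ← mul_assoc, hQsN, mul_assoc, hNV, mul_one]
  have hRs : star (Q * star Q * V) = Q * star Q * V := by
    rw [← hR]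
    simp [(IsSelfAdjoint.of_nonneg hT0).star_eq, (IsSelfAdjoint.of_nonneg hV0).star_eq, mul_assoc]
  -- From `RQ = Q` one gets `(1 - R)T²(1 - R)* = (1 - R)QQ*(1 - R)* = 0`.
  have hRT : Q * star Q * V * T = T := by
    have : (1 - Q * star Q * V) * T = 0 := by
      refine mul_eq_zero_of_mul_conjugate_eq_zero (IsSelfAdjoint.of_nonneg hT0) ?_
      rw [hTT, ← mul_assoc, sub_mul _ _ Q, hRQ]
      simp
    rw [sub_mul, one_mul, sub_eq_zero] at this
    exact this.symm
  refine ⟨V * T, hVT.mul_nonneg hV0 hT0, hVT.symm.mul_right (Commute.refl T), ?_, ?_, ?_, ?_⟩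
  · rw [hR, hRT]
  · have hTR : T * (Q * star Q * V) = T := by
      have := congrArg star hRT
      rwa [star_mul, hRs, (IsSelfAdjoint.of_nonneg hT0).star_eq] at this
    rw [mul_assoc (V * T), hR, mul_assoc V, hTR]
  · rw [hR, hRQ]
  · rw [hR, ← mul_assoc, ← mul_assoc, hQQ]

/-- Let `T = |Q*|` for an idempotent `Q`, let `S` be the Moore–Penrose inverse of `T` and
`K = (T + 1)⁻¹`. Then `P = ½ (T + Q*) S K (T + Q)` is a projection, `(2P - 1)Q` is self-adjoint,
`P ≤ PQP` and `(1 - P)Q(1 - P) ≤ 0`. -/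
theorem matched_projection_properties {Q T S K P : 𝓐} (hQQ : Q * Q = Q) (hT0 : 0 ≤ T)
    (hTT : T * T = Q * star Q) (hS0 : 0 ≤ S) (hTS : Commute T S) (hTST : T * S * T = T)
    (hSTS : S * T * S = S) (hRQ : T * S * Q = Q) (hQR : Q * (T * S) = T * S)
    (hTK : (T + 1) * K = 1) (hKT : K * (T + 1) = 1)
    (hP : P = (1 / 2 : ℂ) • ((T + star Q) * S * K * (T + Q))) :
    IsSelfAdjoint P ∧ P * P = P ∧ IsSelfAdjoint ((2 * P - 1) * Q) ∧ P ≤ P * Q * P ∧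
      (1 - P) * Q * (1 - P) ≤ 0 := by
  have hTs : star T = T := (IsSelfAdjoint.of_nonneg hT0).star_eq
  have hSs : star S = S := (IsSelfAdjoint.of_nonneg hS0).star_eq
  have hKs : star K = K := by
    have h1 : star K * (T + 1) = 1 := by
      have := congrArg star hTK
      rwa [star_mul, star_one, star_add, star_one, hTs] at this
    calc star K = star K * ((T + 1) * K) := by rw [hTK, mul_one]
      _ = K := by rw [← mul_assoc, h1, one_mul]
  have hKnn : 0 ≤ K := by
    have h := star_left_conjugate_nonneg (add_nonneg hT0 zero_le_one) K
    rwa [hKs, hKT, one_mul] at h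
  have hcomm : ∀ X : 𝓐, Commute X T → Commute X K := by
    intro X hX
    have h1 : Commute X (T + 1) := hX.add_right (Commute.one_right X)
    calc X * K = K * (T + 1) * X * K := by rw [hKT, one_mul]
      _ = K * (X * (T + 1)) * K := by rw [h1.eq, mul_assoc K]
      _ = K * X := by rw [mul_assoc, mul_assoc, hTK, mul_one]
  have hKTc : Commute T K := hcomm T (Commute.refl T)
  have hKS : Commute S K := hcomm S hTS.symm
  have hSK : star (S * K) = S * K := by rw [star_mul, hSs, hKs, hKS.eq]
  have hQT : Q * T = T := by
    calc Q * T = Q * (T * S) * T := by rw [mul_assoc, hTST]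
      _ = T := by rw [hQR, hTST]
  have hTQ' : T * star Q = T := by
    have := congrArg star hQT
    rwa [star_mul, hTs] at this
  have hM2 : (2 : ℂ) • P = (T + star Q) * S * K * (T + Q) := by rw [hP, smul_smul]; norm_num
  have hPs : star P = P := by
    rw [hP, star_smul]
    congr 1
    · simp
    · rw [star_mul, mul_assoc (T + star Q), star_mul, hSK]
      simp [hTs, mul_assoc]
  -- `(T + Q) (T + Q*) = 2 T (T + 1)`
  have h1 : (T + Q) * (T + star Q) = (2 : ℂ) • (T * (T + 1)) := by
    rw [add_mul, mul_add, mul_add, hTQ', hQT, ← hTT, mul_add, mul_one, two_smul]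
    abel
  have hT1S : Commute S (T + 1) := hTS.symm.add_right (Commute.one_right S)
  -- `SK` is a reflexive generalized inverse of `T(T + 1)`, half of `(T + Q)(T + Q*)`; with the
  -- factor `½` this is what makes `P` idempotent.
  have h2 : S * K * (T * (T + 1)) * (S * K) = S * K := by
    calc S * K * (T * (T + 1)) * (S * K) = S * T * (K * (T + 1)) * S * K := by
          simp only [mul_assoc]
          rw [← mul_assoc K T, ← hKTc.eq, mul_assoc]
      _ = S * K := by rw [hKT, mul_one, hSTS]
  have hPP : P * P = P := by
    have h : (4 : ℂ) • (P * P) = (4 : ℂ) • P := by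
      calc (4 : ℂ) • (P * P) = ((2 : ℂ) • P) * ((2 : ℂ) • P) := by
            rw [smul_mul_smul_comm]; norm_num
        _ = (T + star Q) * (S * K * ((T + Q) * (T + star Q)) * (S * K)) * (T + Q) := by
            rw [hM2]; simp only [mul_assoc]
        _ = (2 : ℂ) • ((T + star Q) * (S * K) * (T + Q)) := by
            rw [h1, mul_smul_comm, smul_mul_assoc, h2, mul_smul_comm, smul_mul_assoc]
        _ = (4 : ℂ) • P := by
            rw [← mul_assoc (T + star Q), ← hM2, smul_smul]; norm_num
    exact smul_right_injective 𝓐 (by norm_num : (4 : ℂ) ≠ 0) h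
  -- `Q(T + Q*) = T + T² = T(T + 1)` cancels `K`, and `TS` fixes both `T` and `Q`.
  have hQP : (2 : ℂ) • (Q * P) = T + Q := by
    calc (2 : ℂ) • (Q * P) = Q * (T + star Q) * S * K * (T + Q) := by
          rw [← mul_smul_comm, hM2]; simp only [mul_assoc]
      _ = T * (S * ((T + 1) * K)) * (T + Q) := by
          rw [mul_add Q, hQT, ← hTT, add_comm, ← mul_add_one T T, mul_assoc T, ← hT1S.eq,
            mul_assoc T, mul_assoc S]
      _ = T + Q := by rw [hTK, mul_one, mul_add, hTST, hRQ]
  have hPQ : (2 : ℂ) • (P * Q) = Q + star Q * S * Q := by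
    have hTQQ : (T + Q) * Q = (T + 1) * Q := by rw [add_mul, add_mul, hQQ, one_mul]
    calc (2 : ℂ) • (P * Q) = (T + star Q) * S * (K * ((T + Q) * Q)) := by
          rw [← smul_mul_assoc, hM2]; simp only [mul_assoc]
      _ = Q + star Q * S * Q := by
          rw [hTQQ, ← mul_assoc K, hKT, one_mul, add_mul, add_mul, hRQ]
  have hJQ : (2 * P - 1) * Q = star Q * S * Q := by
    rw [sub_mul, one_mul, mul_assoc, two_mul, ← two_smul ℂ, hPQ]
    abel
  have hJQ0 : 0 ≤ (2 * P - 1) * Q := by rw [hJQ]; exact star_left_conjugate_nonneg hS0 Q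
  -- With `R = TS`, `(Q - R)(Q - R)* = T² - R ≥ 0`. The square root is operator monotone and fixes
  -- the projection `R`, so `R ≤ T`.
  have hTS1 : T * S ≤ T := by
    have hRs : star (T * S) = T * S := by rw [star_mul, hTs, hSs, hTS.eq]
    have hRR : T * S * (T * S) = T * S := by rw [← mul_assoc, hTST]
    have hRQ' : T * S * star Q = T * S := by
      have := congrArg star hQR
      rwa [star_mul, hRs] at this
    have h : T * S ≤ T * T := by
      have := mul_star_self_nonneg (Q - T * S)
      rw [star_sub, hRs, sub_mul, mul_sub, mul_sub, ← hTT, hRQ', hQR, hRR, sub_self,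
        sub_zero] at this
      exact sub_nonneg.mp this
    have := CFC.sqrt_le_sqrt _ _ h
    rwa [CFC.sqrt_mul_self T hT0, CFC.sqrt_unique hRR (hTS.mul_nonneg hT0 hS0)] at this
  refine ⟨hPs, hPP, IsSelfAdjoint.of_nonneg hJQ0, ?_, ?_⟩
  · have h4 : (4 : ℂ) • (P * Q * P - P) = (T + star Q) * (S * K * (T - 1)) * (T + Q) := by
      have hTQTQ : (T + Q) * (T + Q) = (T + 1) * (T + Q) := by
        rw [add_mul, add_mul, mul_add Q, hQT, hQQ, one_mul]
      calc (4 : ℂ) • (P * Q * P - P)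
          = ((2 : ℂ) • P) * ((2 : ℂ) • (Q * P)) - (2 : ℂ) • ((2 : ℂ) • P) := by
            rw [smul_mul_smul_comm, smul_smul, smul_sub, mul_assoc]; norm_num
        _ = (T + star Q) * (S * K) * ((T + 1) * (T + Q)) -
              (2 : ℂ) • ((T + star Q) * (S * K) * (T + Q)) := by
            rw [hQP, hM2, ← hTQTQ]; simp only [mul_assoc]
        _ = (T + star Q) * (S * K * (T - 1)) * (T + Q) := by
            rw [two_smul]; noncomm_ring
    have h5 : 0 ≤ S * K * (T - 1) := by
      -- `SK = SK·TS`, so the `1` may be replaced by the projection `TS`; only then is the last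
      -- factor positive.
      have h : S * K * (T - 1) = S * K * (T - T * S) := by
        rw [mul_sub, mul_sub, mul_one, mul_assoc S K (T * S), ← mul_assoc K T, ← hKTc.eq,
          mul_assoc T, ← hKS.eq, ← mul_assoc T, ← mul_assoc S, ← mul_assoc S, hSTS]
      rw [h]
      refine Commute.mul_nonneg (hKS.mul_nonneg hS0 hKnn) (sub_nonneg.mpr hTS1) ?_
      exact Commute.mul_left (hTS.symm.sub_right (hTS.symm.mul_right (Commute.refl S)))
        (hKTc.symm.sub_right (hKTc.symm.mul_right hKS.symm))
    have h6 : P * Q * P - P = (1 / 4 : ℝ) • ((T + star Q) * (S * K * (T - 1)) * (T + Q)) := by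
      rw [← h4, ← Complex.coe_smul, smul_smul]; norm_num
    rw [← sub_nonneg, h6]
    refine smul_nonneg (by norm_num) ?_
    have := star_left_conjugate_nonneg h5 (T + Q)
    rwa [star_add, hTs] at this
  · have h := star_left_conjugate_nonneg hJQ0 (1 - P)
    -- `2P - 1` acts as `-1` on the range of `1 - P`.
    have h7 : star (1 - P) * ((2 * P - 1) * Q) * (1 - P) = -((1 - P) * Q * (1 - P)) := by
      have : (1 - P) * (2 * P - 1) = -(1 - P) := by
        rw [two_mul, mul_sub, mul_add, sub_mul, hPP]; simp
      rw [star_sub, star_one, hPs, ← mul_assoc, this, neg_mul, neg_mul]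
    rw [h7] at h
    exact neg_nonneg.mp h

end CStarAlgebraFacts

/-! ### Moore–Penrose inverses and the matched projection in `𝓛(H)` -/

section MoorePenrose

variable {𝔄 H : Type*} [NonUnitalCStarAlgebra 𝔄] [PartialOrder 𝔄] [StarOrderedRing 𝔄]
  [NormedAddCommGroup H] [NormedSpace ℂ H] [SMul 𝔄 H] [CStarModule 𝔄 H]

/-- `TX` and `TY` are projections with the same range, `XT` and `YT` projections with the same null
space, so they agree in pairs; and `X = XTX` is determined by these products. -/
theorem IsMoorePenroseInverse.unique {T X Y : Adjointable 𝔄 H H}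
    (hX : IsMoorePenroseInverse T X) (hY : IsMoorePenroseInverse T Y) : X = Y := by
  have h1 : T * X = T * Y := by
    calc T * X = star (T * X) := hX.left_selfAdjoint.symm
      _ = star (T * Y * (T * X)) := by rw [← mul_assoc, hY.mul_mul_left]
      _ = T * X * (T * Y) := by rw [star_mul, hX.left_selfAdjoint, hY.left_selfAdjoint]
      _ = T * Y := by rw [← mul_assoc, hX.mul_mul_left]
  have h2 : X * T = Y * T := by
    calc X * T = star (X * T) := hX.right_selfAdjoint.symm
      _ = star (X * T * (Y * T)) := by rw [mul_assoc, ← mul_assoc T, hY.mul_mul_left]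
      _ = Y * T * (X * T) := by rw [star_mul, hX.right_selfAdjoint, hY.right_selfAdjoint]
      _ = Y * T := by rw [mul_assoc, ← mul_assoc T, hX.mul_mul_left]
  calc X = X * T * X := hX.mul_mul_right.symm
    _ = Y * T * Y := by rw [mul_assoc, h1, ← mul_assoc, h2]
    _ = Y := hY.mul_mul_right

theorem IsMoorePenroseInverse.moorePenroseInverse_eq {T X : Adjointable 𝔄 H H}
    (hX : IsMoorePenroseInverse T X) : moorePenroseInverse T = X := by
  have h : ∃ X, IsMoorePenroseInverse T X := ⟨X, hX⟩
  rw [moorePenroseInverse, dif_pos h]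
  exact h.choose_spec.unique hX

theorem matchedProjection_properties [CompleteSpace H] {Q : Adjointable 𝔄 H H}
    (hQ : IsIdempotentElem Q) :
    IsSelfAdjoint (matchedProjection Q) ∧
      matchedProjection Q * matchedProjection Q = matchedProjection Q ∧
      IsSelfAdjoint ((2 * matchedProjection Q - 1) * Q) ∧
      matchedProjection Q ≤ matchedProjection Q * Q * matchedProjection Q ∧
      (1 - matchedProjection Q) * Q * (1 - matchedProjection Q) ≤ 0 := by
  obtain ⟨S, hS0, hTS, hTST, hSTS, hRQ, hQR⟩ := exists_inverse_abs_star_of_isIdempotentElem hQ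
  have hT0 : 0 ≤ CFC.abs (star Q) := CFC.abs_nonneg _
  have hTs : star (CFC.abs (star Q)) = CFC.abs (star Q) := (IsSelfAdjoint.of_nonneg hT0).star_eq
  have hSs : star S = S := (IsSelfAdjoint.of_nonneg hS0).star_eq
  have hMP : moorePenroseInverse (CFC.abs (star Q)) = S :=
    IsMoorePenroseInverse.moorePenroseInverse_eq
      ⟨hTST, hSTS, by rw [star_mul, hSs, hTs, hTS.eq], by rw [star_mul, hSs, hTs, hTS.eq]⟩
  -- Rules out the default value `0` of `Ring.inverse`.
  have hu : IsUnit (CFC.abs (star Q) + 1) := by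
    rw [add_comm]
    exact (isStrictlyPositive_one.add_nonneg hT0).isUnit
  refine matched_projection_properties hQ hT0 (by simpa using CFC.abs_mul_abs (star Q)) hS0 hTS hTST
    hSTS hRQ hQR (Ring.mul_inverse_cancel _ hu) (Ring.inverse_mul_cancel _ hu) ?_
  rw [matchedProjection, hMP]

end MoorePenrose

/-! ### Positivity and approximation in `𝓛(H)` -/

section Positivity

variable {𝔄 H : Type*} [NonUnitalCStarAlgebra 𝔄] [PartialOrder 𝔄] [StarOrderedRing 𝔄]
  [NormedAddCommGroup H] [NormedSpace ℂ H] [CompleteSpace H] [SMul 𝔄 H] [CStarModule 𝔄 H]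

theorem Adjointable.inner_apply_nonneg {T : Adjointable 𝔄 H H} (hT : 0 ≤ T) (x : H) :
    0 ≤ inner 𝔄 x (T x) := by
  obtain ⟨c, rfl⟩ := CStarAlgebra.nonneg_iff_eq_star_mul_self.mp hT
  have : inner 𝔄 x ((star c * c) x) = inner 𝔄 (c x) (c x) := (c.inner_adj x (c x)).symm
  rw [this]
  exact CStarModule.inner_self_nonneg

/-- Testing at `T⁻x` gives `-⟪c T⁻x, c T⁻x⟫ ≥ 0` with `c = (T⁻)^{1/2}`; hence `c T⁻ = 0`, then
`(T⁻)² = 0`, and `T = T⁺`. -/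
theorem Adjointable.nonneg_of_inner_apply_nonneg {T : Adjointable 𝔄 H H} (hT : IsSelfAdjoint T)
    (h : ∀ x, 0 ≤ inner 𝔄 x (T x)) : 0 ≤ T := by
  have hn0 : 0 ≤ T⁻ := CFC.negPart_nonneg T
  have hns : star T⁻ = T⁻ := (IsSelfAdjoint.of_nonneg hn0).star_eq
  have h1 : T * T⁻ = -(T⁻ * T⁻) := by
    calc T * T⁻ = (T⁺ - T⁻) * T⁻ := by rw [CFC.posPart_sub_negPart T hT]
      _ = -(T⁻ * T⁻) := by rw [sub_mul, CFC.posPart_mul_negPart, zero_sub]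
  set c := CFC.sqrt T⁻ with hc
  have hc0 : 0 ≤ c := CFC.sqrt_nonneg _
  have hcs : star c = c := (IsSelfAdjoint.of_nonneg hc0).star_eq
  have hcc : c * c = T⁻ := CFC.sqrt_mul_sqrt_self _ hn0
  have h2 : ∀ x, (c * T⁻) x = 0 := by
    intro x
    have h3 : inner 𝔄 (T⁻ x) (T (T⁻ x)) = -inner 𝔄 ((c * T⁻) x) ((c * T⁻) x) := by
      have e1 : T (T⁻ x) = -(T⁻ (T⁻ x)) := congrArg (fun S : Adjointable 𝔄 H H => S x) h1
      have e2 : inner 𝔄 ((c * T⁻) x) ((c * T⁻) x) = inner 𝔄 (T⁻ x) ((star c * c) (T⁻ x)) :=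
        c.inner_adj (T⁻ x) (c (T⁻ x))
      rw [e1, e2, hcs, hcc, CStarModule.inner_neg_right]
    have h4 := h (T⁻ x)
    rw [h3] at h4
    exact CStarModule.inner_self.mp
      (le_antisymm (neg_nonneg.mp h4) CStarModule.inner_self_nonneg)
  have h5 : c * T⁻ = 0 := Adjointable.ext h2
  have h6 : T⁻ * T⁻ = 0 := by
    rw [← hcc, mul_assoc, hcc, h5, mul_zero]
  have h7 : T⁻ = 0 := by
    rw [← CStarRing.star_mul_self_eq_zero_iff, hns, h6]
  rw [← CFC.posPart_sub_negPart T hT, h7, sub_zero]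
  exact CFC.posPart_nonneg T

/-- For `b ∈ 𝓛(H)` the range of `b*` is contained in the closure of the range of `b* b`. -/
theorem Adjointable.star_apply_mem_closure_range (b : Adjointable 𝔄 H H) (x : H) :
    (star b) x ∈ _root_.closure (Set.range (star b * b).toCLM) := by
  rw [Metric.mem_closure_range_iff]
  intro ε hε
  obtain ⟨δ, hδ, hδε⟩ : ∃ δ : ℝ, 0 < δ ∧ δ * ‖x‖ < ε := by
    refine ⟨ε / (‖x‖ + 1), by positivity, ?_⟩
    rw [div_mul_eq_mul_div, div_lt_iff₀ (by positivity)]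
    nlinarith [norm_nonneg x]
  set h := star b * b with hh
  have hh0 : 0 ≤ h := star_mul_self_nonneg b
  have hsa : IsSelfAdjoint h := IsSelfAdjoint.of_nonneg hh0
  have hsp : ∀ t ∈ spectrum ℝ h, 0 ≤ t := fun t ht => spectrum_nonneg_of_nonneg hh0 ht
  -- Tikhonov regularization: `h g b*` approximates `b*`, the error being `k b*` with `k = δ²(h +
  -- δ²)⁻¹`.
  set g := cfc (fun t : ℝ => 1 / (t + δ ^ 2)) h with hg
  have hne : ∀ t ∈ spectrum ℝ h, t + δ ^ 2 ≠ 0 := fun t ht => by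
    have := hsp t ht
    positivity
  have hgc : ContinuousOn (fun t : ℝ => 1 / (t + δ ^ 2)) (spectrum ℝ h) :=
    continuousOn_const.div (by fun_prop) hne
  set k := 1 - h * g with hk
  have hkc : k = cfc (fun t : ℝ => 1 - t * (1 / (t + δ ^ 2))) h := by
    rw [cfc_sub (fun _ => 1) (fun t : ℝ => t * (1 / (t + δ ^ 2))) h (by fun_prop)
      (by fun_prop), cfc_const_one ℝ h, cfc_mul (fun t : ℝ => t) _ h (by fun_prop) hgc, cfc_id' ℝ h]
  have hks : star k = k := by rw [hkc]; exact IsSelfAdjoint.star_eq (cfc_predicate _ h)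
  have hkhk : k * h * k = cfc (fun t : ℝ => (1 - t * (1 / (t + δ ^ 2))) * t *
      (1 - t * (1 / (t + δ ^ 2)))) h := by
    rw [cfc_mul _ _ h (by fun_prop) (by fun_prop), cfc_mul _ (fun t : ℝ => t) h (by fun_prop)
      (by fun_prop), cfc_id' ℝ h, ← hkc]
  -- `khk = (k b*)(k b*)*`, and on the spectrum it is `δ⁴t/(t + δ²)² ≤ δ²`, because `tδ² ≤ (t +
  -- δ²)²`.
  have hnorm : ‖k * h * k‖ ≤ δ ^ 2 := by
    rw [hkhk]
    refine norm_cfc_le (by positivity) fun t ht => ?_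
    have ht0 := hsp t ht
    have : (1 - t * (1 / (t + δ ^ 2))) * t * (1 - t * (1 / (t + δ ^ 2))) =
        δ ^ 2 * (t * δ ^ 2 / (t + δ ^ 2) ^ 2) := by
      have := hne t ht
      field_simp
      ring
    rw [this, Real.norm_of_nonneg (by positivity)]
    refine mul_le_of_le_one_right (by positivity) ?_
    rw [div_le_one (by positivity)]
    nlinarith [sq_nonneg t, sq_nonneg (δ ^ 2), mul_nonneg ht0 (sq_nonneg δ)]
  have hkb : ‖k * star b‖ ≤ δ := by
    refine abs_le_of_sq_le_sq' ?_ hδ.le |>.2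
    rw [sq, ← CStarRing.norm_self_mul_star, star_mul, star_star, hks]
    simpa [hh, mul_assoc] using hnorm
  refine ⟨(g * star b) x, ?_⟩
  have : (star b) x - h ((g * star b) x) = (k * star b) x := by
    have : k * star b = star b - h * (g * star b) := by rw [hk, sub_mul, one_mul, mul_assoc]
    rw [this]; rfl
  rw [dist_eq_norm, this]
  calc ‖(k * star b) x‖ ≤ ‖k * star b‖ * ‖x‖ := (k * star b).toCLM.le_opNorm x
    _ ≤ δ * ‖x‖ := by gcongr
    _ < ε := hδε

end Positivity

/-! ### Unitaries from operators of equal modulus -/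

namespace Adjointable

variable {𝔄 K X Y : Type*} [NonUnitalCStarAlgebra 𝔄] [PartialOrder 𝔄] [StarOrderedRing 𝔄]
  [NormedAddCommGroup K] [NormedSpace ℂ K] [SMul 𝔄 K] [CStarModule 𝔄 K]
  [NormedAddCommGroup X] [NormedSpace ℂ X] [SMul 𝔄 X] [CStarModule 𝔄 X]
  [NormedAddCommGroup Y] [NormedSpace ℂ Y] [SMul 𝔄 Y] [CStarModule 𝔄 Y]

theorem eq_of_comp_eq_of_denseRange {S T : Adjointable 𝔄 X Y} {C : Adjointable 𝔄 K X}
    (hC : DenseRange C.toCLM) (h : S.comp C = T.comp C) : S = T := by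
  refine ext fun x => ?_
  have : (S.toCLM : X → Y) = T.toCLM :=
    hC.equalizer S.toCLM.continuous T.toCLM.continuous
      (funext fun u => congrArg (fun R : Adjointable 𝔄 K Y => R u) h)
  exact congrFun this x

/-- Two operators of dense range with the same modulus differ by a unitary. -/
theorem exists_isUnitary_comp_eq [CompleteSpace X] [CompleteSpace Y] {C : Adjointable 𝔄 K X}
    {B : Adjointable 𝔄 K Y} (hC : DenseRange C.toCLM) (hB : DenseRange B.toCLM)
    (h : C.adjoint.comp C = B.adjoint.comp B) :
    ∃ U : Adjointable 𝔄 X Y, U.IsUnitary ∧ U.comp C = B := by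
  have hinner : ∀ u v, inner 𝔄 (B u) (B v) = inner 𝔄 (C u) (C v) := by
    intro u v
    rw [B.inner_adj, C.inner_adj]
    exact congrArg (fun R : Adjointable 𝔄 K K => inner 𝔄 u (R v)) h.symm
  have hnorm : ∀ u, ‖B u‖ = ‖C u‖ := by
    intro u
    rw [CStarModule.norm_eq_sqrt_norm_inner_self (A := 𝔄) (B u), hinner,
      ← CStarModule.norm_eq_sqrt_norm_inner_self]
  -- Equal moduli make `Cu ↦ Bu` well defined and isometric between dense subspaces, so it extends
  -- to a bijective isometry.
  let V : X ≃ₗᵢ[ℂ] Y := (LinearEquiv.refl ℂ K).extendOfIsometry (C.toCLM : K →ₗ[ℂ] X)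
    (B.toCLM : K →ₗ[ℂ] Y) hC hB hnorm
  have hV : ∀ u, V (C u) = B u := fun u =>
    LinearEquiv.extendOfIsometry_eq (LinearEquiv.refl ℂ K) (e₁ := (C.toCLM : K →ₗ[ℂ] X))
      (e₂ := (B.toCLM : K →ₗ[ℂ] Y)) hC hB hnorm u
  have hV' : ∀ u, V.symm (B u) = C u := fun u => by rw [← hV, V.symm_apply_apply]
  let U : Adjointable 𝔄 X Y :=
    { toCLM := V.toContinuousLinearEquiv
      adjCLM := V.symm.toContinuousLinearEquiv
      inner_adj := by
        intro x y
        change inner 𝔄 (V x) y = inner 𝔄 x (V.symm y)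
        -- An isometry need not be adjointable a priori; that `V⁻¹` is its adjoint is checked on the
        -- dense ranges and extended by continuity.
        refine hC.induction_on (p := fun x => inner 𝔄 (V x) y = inner 𝔄 x (V.symm y)) x
          (isClosed_eq ?_ ?_) fun u => ?_
        · exact CStarModule.continuous_inner.comp (V.continuous.prodMk continuous_const)
        · exact CStarModule.continuous_inner.comp (continuous_id.prodMk continuous_const)
        refine hB.induction_on (p := fun y => inner 𝔄 (V (C u)) y = inner 𝔄 (C u) (V.symm y)) y
          (isClosed_eq ?_ ?_) fun v => ?_
        · exact CStarModule.continuous_inner.comp (continuous_const.prodMk continuous_id)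
        · exact CStarModule.continuous_inner.comp (continuous_const.prodMk V.symm.continuous)
        rw [hV, hV', hinner] }
  refine ⟨U, ⟨ext fun x => V.symm_apply_apply x, ext fun y => V.apply_symm_apply y⟩, ext hV⟩

end Adjointable

/-! ### Projections onto orthogonally complemented submodules -/

namespace CStarSubmodule

variable {𝔄 H K : Type*} [NonUnitalCStarAlgebra 𝔄] [PartialOrder 𝔄] [StarOrderedRing 𝔄]
  [NormedAddCommGroup H] [NormedSpace ℂ H] [SMul 𝔄 H] [CStarModule 𝔄 H]
  [NormedAddCommGroup K] [NormedSpace ℂ K] [SMul 𝔄 K] [CStarModule 𝔄 K]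

theorem ext_mem {M N : CStarSubmodule 𝔄 H} (h : ∀ x, x ∈ M.toSubmodule ↔ x ∈ N.toSubmodule) :
    M = N := by
  rcases M with ⟨M, _⟩
  rcases N with ⟨N, _⟩
  obtain rfl : M = N := Submodule.ext h
  rfl

theorem IsOrthogonallyComplemented.sub_projection_mem {M : CStarSubmodule 𝔄 H}
    (h : M.IsOrthogonallyComplemented) (x : H) :
    x - (M.projection x : H) ∈ M.orthogonal.toSubmodule := by
  rw [CStarSubmodule.projection, dif_pos h]
  exact (h.exists_decomp x).choose_spec

theorem IsOrthogonallyComplemented.projection_adjoint_apply {M : CStarSubmodule 𝔄 H}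
    (h : M.IsOrthogonallyComplemented) (x : M.toSubmodule) :
    M.projection.adjoint x = (x : H) := by
  rw [CStarSubmodule.projection, dif_pos h]
  rfl

theorem IsOrthogonallyComplemented.projection_eq {M : CStarSubmodule 𝔄 H}
    (h : M.IsOrthogonallyComplemented) {x : H} {m : M.toSubmodule}
    (hm : x - m ∈ M.orthogonal.toSubmodule) : M.projection x = m :=
  decomp_unique (h.sub_projection_mem x) hm

theorem IsOrthogonallyComplemented.projection_coe {M : CStarSubmodule 𝔄 H}
    (h : M.IsOrthogonallyComplemented) (m : M.toSubmodule) : M.projection (m : H) = m :=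
  h.projection_eq (by rw [sub_self]; exact zero_mem _)

theorem IsOrthogonallyComplemented.projection_comp_adjoint {M : CStarSubmodule 𝔄 H}
    (h : M.IsOrthogonallyComplemented) :
    M.projection.comp M.projection.adjoint = Adjointable.id 𝔄 M :=
  Adjointable.ext fun m => by
    change M.projection (M.projection.adjoint m) = m
    rw [h.projection_adjoint_apply, h.projection_coe]

/-- The projection `P_M`, viewed in `𝓛(H)`. -/
def projectionEnd (M : CStarSubmodule 𝔄 H) : Adjointable 𝔄 H H :=
  M.projection.adjoint.comp M.projection

theorem star_projectionEnd (M : CStarSubmodule 𝔄 H) : star M.projectionEnd = M.projectionEnd :=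
  rfl

theorem IsOrthogonallyComplemented.projectionEnd_apply {M : CStarSubmodule 𝔄 H}
    (h : M.IsOrthogonallyComplemented) (x : H) : M.projectionEnd x = M.projection x :=
  h.projection_adjoint_apply _

theorem IsOrthogonallyComplemented.projectionEnd_apply_of_mem {M : CStarSubmodule 𝔄 H}
    (h : M.IsOrthogonallyComplemented) {x : H} (hx : x ∈ M.toSubmodule) :
    M.projectionEnd x = x := by
  rw [h.projectionEnd_apply, h.projection_coe ⟨x, hx⟩]

/-- For `y ∈ M`, `⟪ex, y⟫ = ⟪x, ey⟫ = ⟪x, y⟫`, so `x = ex + (x - ex)` is the orthogonal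
decomposition. This produces the projections onto `H₁` and `H₄`. -/
theorem isOrthogonallyComplemented_of_isSelfAdjoint {M : CStarSubmodule 𝔄 H}
    {e : Adjointable 𝔄 H H} (he : star e = e) (hM : ∀ x, e x ∈ M.toSubmodule)
    (hfix : ∀ x ∈ M.toSubmodule, e x = x) :
    M.IsOrthogonallyComplemented ∧ M.projectionEnd = e := by
  have hperp : ∀ x, x - e x ∈ M.orthogonal.toSubmodule := fun x y hy => by
    have : inner 𝔄 (e x) y = inner 𝔄 x ((star e) y) := e.inner_adj x y
    rw [CStarModule.inner_sub_left, this, he, hfix y hy, sub_self]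
  have h : M.IsOrthogonallyComplemented := by
    rw [IsOrthogonallyComplemented, eq_top_iff]
    intro x _
    exact Submodule.mem_sup.mpr ⟨e x, hM x, x - e x, hperp x, by simp⟩
  refine ⟨h, Adjointable.ext fun x => ?_⟩
  rw [h.projectionEnd_apply, h.projection_eq (m := ⟨e x, hM x⟩) (hperp x)]

theorem mem_closure_range_apply (T : Adjointable 𝔄 H K) (x : H) :
    T x ∈ (range T).closure.toSubmodule :=
  (range T).toSubmodule.le_topologicalClosure ⟨x, rfl⟩

theorem eqOn_closure_range {L : Type*} [NormedAddCommGroup L] [NormedSpace ℂ L] [SMul 𝔄 L]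
    [CStarModule 𝔄 L] {T : Adjointable 𝔄 L H} {R S : Adjointable 𝔄 H K}
    (h : R.comp T = S.comp T) {x : H} (hx : x ∈ (range T).closure.toSubmodule) : R x = S x := by
  have hx' : x ∈ _root_.closure (Set.range T.toCLM) := hx
  refine closure_minimal (t := {x | R x = S x}) ?_
    (isClosed_eq R.toCLM.continuous S.toCLM.continuous) hx'
  rintro _ ⟨u, rfl⟩
  exact congrArg (fun V : Adjointable 𝔄 L K => V u) h

theorem IsOrthogonallyComplemented.projectionEnd_mul {T : Adjointable 𝔄 H H}
    (h : (range T).closure.IsOrthogonallyComplemented) :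
    (range T).closure.projectionEnd * T = T :=
  Adjointable.ext fun x => h.projectionEnd_apply_of_mem (mem_closure_range_apply T x)

/-- By continuity, identities on `H₅` and `H₆` need only be verified after multiplying by the corner
of `Q` whose range is dense there. -/
theorem IsOrthogonallyComplemented.mul_projectionEnd_eq {T : Adjointable 𝔄 H H}
    (h : (range T).closure.IsOrthogonallyComplemented)
    {R S : Adjointable 𝔄 H H}
    (hRS : R * T = S * T) :
    R * (range T).closure.projectionEnd = S * (range T).closure.projectionEnd :=
  Adjointable.ext fun x => by
    change R ((range T).closure.projectionEnd x) = S ((range T).closure.projectionEnd x)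
    rw [h.projectionEnd_apply]
    exact eqOn_closure_range hRS (Subtype.prop _)

/-- The null space of `T*` is orthogonal to the range of `T`, hence to its closure. -/
theorem IsOrthogonallyComplemented.projectionEnd_apply_eq_zero {T : Adjointable 𝔄 H H}
    (h : (range T).closure.IsOrthogonallyComplemented)
    {x : H} (hx : (star T) x = 0) :
    (range T).closure.projectionEnd x = 0 := by
  have hx' : x ∈ (range T).closure.orthogonal.toSubmodule := by
    intro y hy
    have hy' : y ∈ _root_.closure (Set.range T.toCLM) := hy
    refine closure_minimal (t := {y | inner 𝔄 x y = 0}) ?_ (isClosed_eq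
      (CStarModule.continuous_inner.comp (continuous_const.prodMk continuous_id))
      continuous_const) hy'
    rintro _ ⟨u, rfl⟩
    have : inner 𝔄 ((star T) x) u = inner 𝔄 x (T u) := (star T).inner_adj x u
    change inner 𝔄 x (T u) = 0
    rw [← this, hx, CStarModule.inner_zero_left]
  rw [h.projectionEnd_apply, h.projection_eq (m := 0) (by simpa using hx')]
  rfl

theorem IsOrthogonallyComplemented.denseRange_projection_comp {T : Adjointable 𝔄 H H}
    (h : (range T).closure.IsOrthogonallyComplemented)
    {S : Adjointable 𝔄 H H}
    (hS : ∀ x, T x ∈ _root_.closure (Set.range S.toCLM)) :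
    DenseRange ((range T).closure.projection.comp S).toCLM := by
  intro y
  have hy : (y : H) ∈ _root_.closure (Set.range S.toCLM) :=
    closure_minimal (by rintro _ ⟨x, rfl⟩; exact hS x) isClosed_closure y.2
  have := map_mem_closure (t := Set.range ((range T).closure.projection.comp S).toCLM)
    (range T).closure.projection.toCLM.continuous hy
    (by rintro _ ⟨x, rfl⟩; exact ⟨x, rfl⟩)
  rwa [h.projection_coe y] at this

end CStarSubmodule

/-! ### Coordinates of columns and block operators -/

theorem Adjointable.prod_ext {𝔄 H K : Type*} {x y : C⋆ᵐᵒᵈ(𝔄, H × K)} (h1 : x.1 = y.1)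
    (h2 : x.2 = y.2) : x = y :=
  (WithCStarModule.equiv 𝔄 (H × K)).injective (Prod.ext h1 h2)

namespace Adjointable

variable {𝔄 H K L : Type*} [NonUnitalCStarAlgebra 𝔄] [PartialOrder 𝔄] [StarOrderedRing 𝔄]
  [NormedAddCommGroup H] [NormedSpace ℂ H] [SMul 𝔄 H] [CStarModule 𝔄 H]
  [NormedAddCommGroup K] [NormedSpace ℂ K] [SMul 𝔄 K] [CStarModule 𝔄 K]
  [NormedAddCommGroup L] [NormedSpace ℂ L] [SMul 𝔄 L] [CStarModule 𝔄 L]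

theorem mul_apply (S T : Adjointable 𝔄 H H) (x : H) : (S * T) x = S (T x) := rfl

theorem one_apply (x : H) : (1 : Adjointable 𝔄 H H) x = x := rfl

theorem zero_apply (x : H) : (0 : Adjointable 𝔄 H K) x = 0 := rfl

theorem add_apply (S T : Adjointable 𝔄 H K) (x : H) : (S + T) x = S x + T x := rfl

theorem sub_apply (S T : Adjointable 𝔄 H K) (x : H) : (S - T) x = S x - T x := rfl

theorem neg_apply (S : Adjointable 𝔄 H K) (x : H) : (-S) x = -S x := rfl

theorem comp_apply (S : Adjointable 𝔄 K L) (T : Adjointable 𝔄 H K) (x : H) :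
    (S.comp T) x = S (T x) := rfl

theorem eq_zero_of_isUnit_of_apply_eq_zero {V : Adjointable 𝔄 H H} (hV : IsUnit V) {x : H}
    (hx : V x = 0) : x = 0 := by
  obtain ⟨u, rfl⟩ := hV
  have : ((↑u⁻¹ : Adjointable 𝔄 H H) * u) x = 0 := by
    rw [mul_apply, hx, map_zero]
  rwa [Units.inv_mul, one_apply] at this

theorem column_apply_fst (S : Adjointable 𝔄 L H) (T : Adjointable 𝔄 L K) (x : L) :
    (column S T x).1 = S x :=
  add_zero (S x)

theorem column_apply_snd (S : Adjointable 𝔄 L H) (T : Adjointable 𝔄 L K) (x : L) :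
    (column S T x).2 = T x :=
  zero_add (T x)

theorem column_adjoint_apply (S : Adjointable 𝔄 L H) (T : Adjointable 𝔄 L K)
    (y : C⋆ᵐᵒᵈ(𝔄, H × K)) : (column S T).adjoint y = S.adjoint y.1 + T.adjoint y.2 := rfl

theorem block_apply_fst (a : Adjointable 𝔄 H H) (b : Adjointable 𝔄 K H) (c : Adjointable 𝔄 H K)
    (d : Adjointable 𝔄 K K) (y : C⋆ᵐᵒᵈ(𝔄, H × K)) : (block a b c d y).1 = a y.1 + b y.2 :=
  column_apply_fst _ _ _

theorem block_apply_snd (a : Adjointable 𝔄 H H) (b : Adjointable 𝔄 K H) (c : Adjointable 𝔄 H K)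
    (d : Adjointable 𝔄 K K) (y : C⋆ᵐᵒᵈ(𝔄, H × K)) : (block a b c d y).2 = c y.1 + d y.2 :=
  column_apply_snd _ _ _

theorem directSum_apply_fst (S : Adjointable 𝔄 H H) (T : Adjointable 𝔄 K K)
    (y : C⋆ᵐᵒᵈ(𝔄, H × K)) : (directSum S T y).1 = S y.1 := by
  rw [directSum, block_apply_fst, zero_apply, add_zero]

theorem directSum_apply_snd (S : Adjointable 𝔄 H H) (T : Adjointable 𝔄 K K)
    (y : C⋆ᵐᵒᵈ(𝔄, H × K)) : (directSum S T y).2 = T y.2 := by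
  rw [directSum, block_apply_snd, zero_apply, zero_add]

end Adjointable

/-- A projection `P` and an idempotent `Q` for which `(2P - 1)Q` is self-adjoint, with
`P ≤ PQP` and `(1 - P)Q(1 - P) ≤ 0`. -/
structure IsMatchedPair {𝔄 H : Type*} [NonUnitalCStarAlgebra 𝔄] [PartialOrder 𝔄]
    [StarOrderedRing 𝔄] [NormedAddCommGroup H] [NormedSpace ℂ H] [CompleteSpace H] [SMul 𝔄 H]
    [CStarModule 𝔄 H] (P Q : Adjointable 𝔄 H H) : Prop where
  star_left : star P = P
  left_mul_self : P * P = P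
  right_mul_self : Q * Q = Q
  isSelfAdjoint : IsSelfAdjoint ((2 * P - 1) * Q)
  le_compression : P ≤ P * Q * P
  compression_nonpos : (1 - P) * Q * (1 - P) ≤ 0

/-! ### Consequences of the matched pair relations -/

namespace IsMatchedPair

variable {𝔄 H : Type*} [NonUnitalCStarAlgebra 𝔄] [PartialOrder 𝔄] [StarOrderedRing 𝔄]
  [NormedAddCommGroup H] [NormedSpace ℂ H] [CompleteSpace H] [SMul 𝔄 H] [CStarModule 𝔄 H]
  {P Q : Adjointable 𝔄 H H}

theorem left_apply_apply (h : IsMatchedPair P Q) (x : H) : P (P x) = P x :=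
  congrArg (fun T : Adjointable 𝔄 H H => T x) h.left_mul_self

theorem right_apply_apply (h : IsMatchedPair P Q) (x : H) : Q (Q x) = Q x :=
  congrArg (fun T : Adjointable 𝔄 H H => T x) h.right_mul_self

theorem star_mul_eq (h : IsMatchedPair P Q) : star Q * (2 * P - 1) = (2 * P - 1) * Q := by
  have := h.isSelfAdjoint.star_eq
  rwa [star_mul, star_sub, star_mul, h.star_left, star_one, star_ofNat, mul_two, ← two_mul] at this

/-- This operator is `PQP` on `𝓡(P)` and the identity on `𝓝(P)`. -/
theorem isUnit_one_add (h : IsMatchedPair P Q) : IsUnit (1 + (P * Q * P - P)) :=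
  (isStrictlyPositive_one.add_nonneg (sub_nonneg.mpr h.le_compression)).isUnit

theorem isUnit_one_sub (h : IsMatchedPair P Q) : IsUnit (1 - (1 - P) * Q * (1 - P)) := by
  rw [sub_eq_add_neg]
  exact (isStrictlyPositive_one.add_nonneg (neg_nonneg.mpr h.compression_nonpos)).isUnit

/-- Compress `Q*(2P - 1) = (2P - 1)Q`: the symmetry acts as `1` on `𝓡(P)` and as `-1` on `𝓝(P)`. -/
theorem mul_star_mul_one_sub (h : IsMatchedPair P Q) :
    P * star Q * (1 - P) = -(P * Q * (1 - P)) := by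
  have hP := h.left_mul_self
  have h1 : (2 * P - 1) * (1 - P) = -(1 - P) := by
    rw [two_mul, mul_sub, mul_one, sub_mul, add_mul, hP, one_mul]; abel
  have h2 : P * (2 * P - 1) = P := by
    rw [two_mul, mul_sub, mul_add, hP]; simp
  calc P * star Q * (1 - P) = -(P * (star Q * (2 * P - 1)) * (1 - P)) := by
        rw [mul_assoc, mul_assoc, mul_assoc, h1, mul_neg, mul_neg, neg_neg]
    _ = -(P * Q * (1 - P)) := by rw [h.star_mul_eq, ← mul_assoc P, h2]

theorem star_lowerCorner (h : IsMatchedPair P Q) :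
    star ((1 - P) * Q * P) = -(P * Q * (1 - P)) := by
  rw [← h.mul_star_mul_one_sub, star_mul, star_mul, star_sub, star_one, h.star_left, mul_assoc]

theorem star_upperCorner (h : IsMatchedPair P Q) :
    star (P * Q * (1 - P)) = -((1 - P) * Q * P) := by
  rw [← neg_neg (P * Q * (1 - P)), ← h.star_lowerCorner, star_neg, star_star]

/-- The vector `Qx - x` lies in `𝓡(P) ∩ 𝓝(Q)`, so the invertible `1 + (PQP - P)` kills it. -/
theorem right_apply_eq_self (h : IsMatchedPair P Q) {x : H} (hx : P x = x)
    (hQx : P (Q x) = Q x) : Q x = x := by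
  rw [← sub_eq_zero]
  refine Adjointable.eq_zero_of_isUnit_of_apply_eq_zero h.isUnit_one_add ?_
  simp only [Adjointable.add_apply, Adjointable.sub_apply, Adjointable.mul_apply, Adjointable.one_apply,
    map_sub, hx, hQx, h.right_apply_apply]
  abel

/-- The vector `Qx` lies in `𝓝(P) ∩ 𝓡(Q)`, so the invertible `1 - (1 - P)Q(1 - P)` kills it. -/
theorem right_apply_eq_zero (h : IsMatchedPair P Q) {x : H} (hQx : P (Q x) = 0) :
    Q x = 0 := by
  refine Adjointable.eq_zero_of_isUnit_of_apply_eq_zero h.isUnit_one_sub ?_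
  simp only [Adjointable.sub_apply, Adjointable.mul_apply, Adjointable.one_apply, hQx,
    h.right_apply_apply, sub_zero,
    sub_self]

theorem apply_of_mem_range (h : IsMatchedPair P Q) {x : H}
    (hx : x ∈ (CStarSubmodule.range P).toSubmodule) : P x = x := by
  obtain ⟨y, rfl⟩ := hx
  exact h.left_apply_apply y

theorem apply_of_mem_range_right (h : IsMatchedPair P Q) {x : H}
    (hx : x ∈ (CStarSubmodule.range Q).toSubmodule) : Q x = x := by
  obtain ⟨y, rfl⟩ := hx
  exact h.right_apply_apply y

theorem halmosH2_eq_bot (h : IsMatchedPair P Q) : halmosH2 P Q = ⊥ := by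
  refine CStarSubmodule.ext_mem fun x => ⟨fun hx => ?_, fun hx => ?_⟩
  · have h1 : P x = x := h.apply_of_mem_range hx.1
    have h2 : Q x = 0 := hx.2
    refine Adjointable.eq_zero_of_isUnit_of_apply_eq_zero h.isUnit_one_add ?_
    simp only [Adjointable.add_apply, Adjointable.sub_apply, Adjointable.mul_apply, Adjointable.one_apply,
      h1, h2, map_zero, zero_sub, add_neg_cancel]
  · obtain rfl : x = 0 := hx
    exact zero_mem _

theorem halmosH3_eq_bot (h : IsMatchedPair P Q) : halmosH3 P Q = ⊥ := by
  refine CStarSubmodule.ext_mem fun x => ⟨fun hx => ?_, fun hx => ?_⟩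
  · have h1 : P x = 0 := hx.1
    have h2 : Q x = x := h.apply_of_mem_range_right hx.2
    refine Adjointable.eq_zero_of_isUnit_of_apply_eq_zero h.isUnit_one_sub ?_
    simp only [Adjointable.sub_apply, Adjointable.mul_apply, Adjointable.one_apply, h1, h2,
      sub_zero, sub_self]
  · obtain rfl : x = 0 := hx
    exact zero_mem _

/-! ### The corner projections -/

theorem left_mul_projectionEnd_five (h : IsMatchedPair P Q)
    (h5 : (halmosH5 P Q).IsOrthogonallyComplemented) :
    P * (halmosH5 P Q).projectionEnd = (halmosH5 P Q).projectionEnd := by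
  have := h5.mul_projectionEnd_eq (R := P) (S := 1)
    (by rw [← mul_assoc, ← mul_assoc, h.left_mul_self, one_mul])
  rwa [one_mul] at this

theorem projectionEnd_five_mul_left (h : IsMatchedPair P Q)
    (h5 : (halmosH5 P Q).IsOrthogonallyComplemented) :
    (halmosH5 P Q).projectionEnd * P = (halmosH5 P Q).projectionEnd := by
  have := congrArg star (h.left_mul_projectionEnd_five h5)
  rwa [star_mul, h.star_left, CStarSubmodule.star_projectionEnd] at this

theorem left_mul_projectionEnd_six (h : IsMatchedPair P Q)
    (h6 : (halmosH6 P Q).IsOrthogonallyComplemented) :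
    P * (halmosH6 P Q).projectionEnd = 0 := by
  have := h6.mul_projectionEnd_eq (R := P) (S := 0)
    (by rw [← mul_assoc, ← mul_assoc, mul_sub, h.left_mul_self]; simp)
  rwa [zero_mul] at this

theorem projectionEnd_six_mul_left (h : IsMatchedPair P Q)
    (h6 : (halmosH6 P Q).IsOrthogonallyComplemented) :
    (halmosH6 P Q).projectionEnd * P = 0 := by
  have := congrArg star (h.left_mul_projectionEnd_six h6)
  rwa [star_mul, h.star_left, CStarSubmodule.star_projectionEnd, star_zero] at this

/-- `P_{H₅}` fixes the upper corner from the left; taking adjoints exchanges the corners up to sign.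
-/
theorem lowerCorner_mul_projectionEnd (h : IsMatchedPair P Q)
    (h5 : (halmosH5 P Q).IsOrthogonallyComplemented) :
    (1 - P) * Q * P * (halmosH5 P Q).projectionEnd = (1 - P) * Q * P := by
  have := congrArg (fun T => -star T) h5.projectionEnd_mul
  rwa [star_mul, CStarSubmodule.star_projectionEnd, h.star_upperCorner, neg_mul, neg_neg,
    neg_neg] at this

theorem upperCorner_mul_projectionEnd (h : IsMatchedPair P Q)
    (h6 : (halmosH6 P Q).IsOrthogonallyComplemented) :
    P * Q * (1 - P) * (halmosH6 P Q).projectionEnd = P * Q * (1 - P) := by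
  have := congrArg (fun T => -star T) h6.projectionEnd_mul
  rwa [star_mul, CStarSubmodule.star_projectionEnd, h.star_lowerCorner, neg_mul, neg_neg,
    neg_neg] at this

/-- `Q` maps `H₅` into `H₅ + H₆`: by `Q² = Q`, both components of `Q` applied to the upper corner
factor through a corner again (`e1`, `e2`). -/
theorem right_mul_projectionEnd_five (h : IsMatchedPair P Q)
    (h5 : (halmosH5 P Q).IsOrthogonallyComplemented)
    (h6 : (halmosH6 P Q).IsOrthogonallyComplemented) :
    Q * (halmosH5 P Q).projectionEnd =
      (halmosH5 P Q).projectionEnd * Q * (halmosH5 P Q).projectionEnd +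
        (halmosH6 P Q).projectionEnd * Q * (halmosH5 P Q).projectionEnd := by
  have hQQ : ∀ X, Q * (Q * X) = Q * X := fun X => by rw [← mul_assoc, h.right_mul_self]
  rw [← add_mul]
  refine h5.mul_projectionEnd_eq ?_
  have e1 : P * (Q * (P * Q * (1 - P))) = P * Q * (1 - P) * (1 - Q * (1 - P)) := by
    simp only [mul_sub, sub_mul, mul_one, mul_assoc, hQQ, h.right_mul_self]
    abel
  have e2 : (1 - P) * (Q * (P * Q * (1 - P))) = (1 - P) * Q * P * (Q * (1 - P)) := by
    simp only [mul_assoc]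
  have f1 : (halmosH5 P Q).projectionEnd * (Q * (P * Q * (1 - P))) =
      P * (Q * (P * Q * (1 - P))) := by
    rw [← h.projectionEnd_five_mul_left h5, mul_assoc, e1, ← mul_assoc, h5.projectionEnd_mul]
  have f2 : (halmosH6 P Q).projectionEnd * (Q * (P * Q * (1 - P))) =
      (1 - P) * (Q * (P * Q * (1 - P))) := by
    have : (halmosH6 P Q).projectionEnd = (halmosH6 P Q).projectionEnd * (1 - P) := by
      rw [mul_sub, h.projectionEnd_six_mul_left h6, mul_one, sub_zero]
    rw [this, mul_assoc, e2, ← mul_assoc, h6.projectionEnd_mul]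
  rw [add_mul, mul_assoc (halmosH5 P Q).projectionEnd, mul_assoc (halmosH6 P Q).projectionEnd, f1,
    f2, ← add_mul, add_sub_cancel, one_mul]

theorem right_mul_projectionEnd_six (h : IsMatchedPair P Q)
    (h5 : (halmosH5 P Q).IsOrthogonallyComplemented)
    (h6 : (halmosH6 P Q).IsOrthogonallyComplemented) :
    Q * (halmosH6 P Q).projectionEnd =
      (halmosH5 P Q).projectionEnd * Q * (halmosH6 P Q).projectionEnd +
        (halmosH6 P Q).projectionEnd * Q * (halmosH6 P Q).projectionEnd := by
  have hQQ : ∀ X, Q * (Q * X) = Q * X := fun X => by rw [← mul_assoc, h.right_mul_self]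
  rw [← add_mul]
  refine h6.mul_projectionEnd_eq ?_
  have e1 : P * (Q * ((1 - P) * Q * P)) = P * Q * (1 - P) * (Q * P) := by
    simp only [mul_assoc]
  have e2 : (1 - P) * (Q * ((1 - P) * Q * P)) = (1 - P) * Q * P * (1 - Q * P) := by
    simp only [mul_sub, sub_mul, mul_one, one_mul, mul_assoc, hQQ]
  have f1 : (halmosH5 P Q).projectionEnd * (Q * ((1 - P) * Q * P)) =
      P * (Q * ((1 - P) * Q * P)) := by
    rw [← h.projectionEnd_five_mul_left h5, mul_assoc, e1, ← mul_assoc, h5.projectionEnd_mul]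
  have f2 : (halmosH6 P Q).projectionEnd * (Q * ((1 - P) * Q * P)) =
      (1 - P) * (Q * ((1 - P) * Q * P)) := by
    have : (halmosH6 P Q).projectionEnd = (halmosH6 P Q).projectionEnd * (1 - P) := by
      rw [mul_sub, h.projectionEnd_six_mul_left h6, mul_one, sub_zero]
    rw [this, mul_assoc, e2, ← mul_assoc, h6.projectionEnd_mul]
  rw [add_mul, mul_assoc (halmosH5 P Q).projectionEnd, mul_assoc (halmosH6 P Q).projectionEnd, f1,
    f2, ← add_mul, add_sub_cancel, one_mul]

/-- The lower corner vanishes on `𝓡(P) ⊖ H₅`, so `Q` keeps such vectors in `𝓡(P)` and therefore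
fixes them. Conversely, a vector of `H₁` is killed by the adjoint of the upper corner, hence is
orthogonal to `H₅`. -/
theorem halmosH1_complemented (h : IsMatchedPair P Q)
    (h5 : (halmosH5 P Q).IsOrthogonallyComplemented) :
    (halmosH1 P Q).IsOrthogonallyComplemented ∧
      (halmosH1 P Q).projectionEnd = P - (halmosH5 P Q).projectionEnd := by
  refine CStarSubmodule.isOrthogonallyComplemented_of_isSelfAdjoint ?_ (fun x => ?_)
    fun x hx => ?_
  · rw [star_sub, h.star_left, CStarSubmodule.star_projectionEnd]
  · set e := P - (halmosH5 P Q).projectionEnd with he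
    have hPe : P * e = e := by
      rw [he, mul_sub, h.left_mul_self, h.left_mul_projectionEnd_five h5]
    have hce : (1 - P) * Q * e = 0 := by
      have : (1 - P) * Q * P * e = 0 := by
        rw [he, mul_sub, h.lowerCorner_mul_projectionEnd h5, mul_assoc _ P, h.left_mul_self,
          sub_self]
      rwa [mul_assoc _ P, hPe] at this
    have h1 : P (e x) = e x := congrArg (fun T : Adjointable 𝔄 H H => T x) hPe
    have h2 : Q (e x) - P (Q (e x)) = 0 := congrArg (fun T : Adjointable 𝔄 H H => T x) hce
    exact ⟨⟨e x, h1⟩, ⟨e x, h.right_apply_eq_self h1 (sub_eq_zero.mp h2).symm⟩⟩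
  · have h1 : P x = x := h.apply_of_mem_range hx.1
    have h2 : Q x = x := h.apply_of_mem_range_right hx.2
    rw [Adjointable.sub_apply, h1, h5.projectionEnd_apply_eq_zero, sub_zero]
    rw [h.star_upperCorner]
    simp only [Adjointable.neg_apply, Adjointable.sub_apply, Adjointable.mul_apply, Adjointable.one_apply,
      h1, h2, sub_self, neg_zero]

/-- The upper corner vanishes on `𝓝(P) ⊖ H₆`, so `Q` sends such vectors into `𝓝(P)` and therefore to
zero. -/
theorem halmosH4_complemented (h : IsMatchedPair P Q)
    (h6 : (halmosH6 P Q).IsOrthogonallyComplemented) :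
    (halmosH4 P Q).IsOrthogonallyComplemented ∧
      (halmosH4 P Q).projectionEnd = 1 - P - (halmosH6 P Q).projectionEnd := by
  refine CStarSubmodule.isOrthogonallyComplemented_of_isSelfAdjoint ?_ (fun x => ?_)
    fun x hx => ?_
  · rw [star_sub, star_sub, star_one, h.star_left, CStarSubmodule.star_projectionEnd]
  · set e := 1 - P - (halmosH6 P Q).projectionEnd with he
    have hPe : P * e = 0 := by
      rw [he, mul_sub, mul_sub, h.left_mul_self, h.left_mul_projectionEnd_six h6]; simp
    have hce : P * Q * e = 0 := by
      have h1 : P * Q * (1 - P) * e = 0 := by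
        have : (1 - P) * (1 - P) = 1 - P := by
          rw [mul_sub, mul_one, sub_mul, h.left_mul_self]; simp
        rw [he, mul_sub, h.upperCorner_mul_projectionEnd h6, mul_assoc _ (1 - P), this, sub_self]
      rwa [mul_assoc _ (1 - P), sub_mul, hPe, one_mul, sub_zero] at h1
    have h1 : P (e x) = 0 := congrArg (fun T : Adjointable 𝔄 H H => T x) hPe
    have h2 : P (Q (e x)) = 0 := congrArg (fun T : Adjointable 𝔄 H H => T x) hce
    exact ⟨h1, h.right_apply_eq_zero h2⟩
  · have h1 : P x = 0 := hx.1
    have h2 : Q x = 0 := hx.2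
    rw [Adjointable.sub_apply, Adjointable.sub_apply, Adjointable.one_apply, h1,
      h6.projectionEnd_apply_eq_zero, sub_zero, sub_zero]
    rw [h.star_lowerCorner]
    simp only [Adjointable.neg_apply, Adjointable.sub_apply, Adjointable.mul_apply, Adjointable.one_apply,
      map_sub, h1, h2, sub_self, neg_zero, map_zero]

end IsMatchedPair

/-! ### Compressions to submodules and the adjoint of `W` -/

namespace CStarSubmodule

variable {𝔄 H : Type*} [NonUnitalCStarAlgebra 𝔄] [PartialOrder 𝔄] [StarOrderedRing 𝔄]
  [NormedAddCommGroup H] [NormedSpace ℂ H] [SMul 𝔄 H] [CStarModule 𝔄 H]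

theorem IsOrthogonallyComplemented.projectionEnd_mul_self {M : CStarSubmodule 𝔄 H}
    (hM : M.IsOrthogonallyComplemented) : M.projectionEnd * M.projectionEnd = M.projectionEnd :=
  Adjointable.ext fun x => hM.projectionEnd_apply_of_mem <| by
    have : M.projectionEnd x ∈ M.toSubmodule := by
      rw [hM.projectionEnd_apply]; exact Subtype.prop _
    exact this

theorem IsOrthogonallyComplemented.projection_coe_eq_zero {M N : CStarSubmodule 𝔄 H}
    (hM : M.IsOrthogonallyComplemented) (hN : N.IsOrthogonallyComplemented)
    (h : M.projectionEnd * N.projectionEnd = 0) (x : N.toSubmodule) :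
    M.projection (x : H) = 0 := by
  have h1 : M.projectionEnd (N.projectionEnd (x : H)) = 0 :=
    congrArg (fun T : Adjointable 𝔄 H H => T x) h
  rw [hN.projectionEnd_apply_of_mem x.2, hM.projectionEnd_apply] at h1
  exact Subtype.ext h1

/-- The compression `P_N T|_M` of `T` to an operator from `M` to `N`. -/
def compression (N M : CStarSubmodule 𝔄 H) (T : Adjointable 𝔄 H H) : Adjointable 𝔄 M N :=
  (N.projection.comp T).comp M.projection.adjoint

theorem IsOrthogonallyComplemented.coe_compression_apply {M N : CStarSubmodule 𝔄 H}
    (hM : M.IsOrthogonallyComplemented) (hN : N.IsOrthogonallyComplemented)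
    (T : Adjointable 𝔄 H H) (x : M.toSubmodule) :
    (compression N M T x : H) = (N.projectionEnd * T * M.projectionEnd) x := by
  rw [Adjointable.mul_apply, hM.projectionEnd_apply_of_mem x.2, Adjointable.mul_apply,
    hN.projectionEnd_apply, compression, Adjointable.comp_apply, Adjointable.comp_apply,
    hM.projection_adjoint_apply]

end CStarSubmodule

theorem halmosUnitary_adjoint_apply {𝔄 H : Type*} [NonUnitalCStarAlgebra 𝔄]
    [PartialOrder 𝔄] [StarOrderedRing 𝔄] [NormedAddCommGroup H] [NormedSpace ℂ H] [SMul 𝔄 H]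
    [CStarModule 𝔄 H] {P Q : Adjointable 𝔄 H H} (h1 : (halmosH1 P Q).IsOrthogonallyComplemented)
    (h4 : (halmosH4 P Q).IsOrthogonallyComplemented)
    (h5 : (halmosH5 P Q).IsOrthogonallyComplemented)
    (h6 : (halmosH6 P Q).IsOrthogonallyComplemented) (y : HalmosSum P Q) :
    (halmosUnitary P Q).adjoint y = (y.1 : H) + ((y.2.1 : H) + ((y.2.2.1 : H) + (y.2.2.2 : H))) := by
  rw [halmosUnitary, Adjointable.column_adjoint_apply, Adjointable.column_adjoint_apply,
    Adjointable.column_adjoint_apply, h1.projection_adjoint_apply, h4.projection_adjoint_apply,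
    h5.projection_adjoint_apply, h6.projection_adjoint_apply]

/-! ### Unitarity of `W` and the conjugates of `P` and `Q` -/

namespace IsMatchedPair

open CStarSubmodule

variable {𝔄 H : Type*} [NonUnitalCStarAlgebra 𝔄] [PartialOrder 𝔄] [StarOrderedRing 𝔄]
  [NormedAddCommGroup H] [NormedSpace ℂ H] [CompleteSpace H] [SMul 𝔄 H] [CStarModule 𝔄 H]
  {P Q : Adjointable 𝔄 H H}

theorem projectionEnd_five_mul_six (h : IsMatchedPair P Q)
    (h5 : (halmosH5 P Q).IsOrthogonallyComplemented)
    (h6 : (halmosH6 P Q).IsOrthogonallyComplemented) :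
    (halmosH5 P Q).projectionEnd * (halmosH6 P Q).projectionEnd = 0 := by
  rw [← h.projectionEnd_five_mul_left h5, mul_assoc, h.left_mul_projectionEnd_six h6, mul_zero]

theorem projectionEnd_six_mul_five (h : IsMatchedPair P Q)
    (h5 : (halmosH5 P Q).IsOrthogonallyComplemented)
    (h6 : (halmosH6 P Q).IsOrthogonallyComplemented) :
    (halmosH6 P Q).projectionEnd * (halmosH5 P Q).projectionEnd = 0 := by
  rw [← h.left_mul_projectionEnd_five h5, ← mul_assoc, h.projectionEnd_six_mul_left h6, zero_mul]

/-- The projections `P - P_{H₅}`, `1 - P - P_{H₆}`, `P_{H₅}`, `P_{H₆}` sum to `1`, giving `W*W = 1`;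
their pairwise orthogonality gives `WW* = 1`. -/
theorem halmosUnitary_isUnitary (h : IsMatchedPair P Q) (hharm : IsHarmonious P Q) :
    (halmosUnitary P Q).IsUnitary := by
  obtain ⟨h5, h6⟩ := hharm
  obtain ⟨h1, e1⟩ := h.halmosH1_complemented h5
  obtain ⟨h4, e4⟩ := h.halmosH4_complemented h6
  have p55 := h5.projectionEnd_mul_self
  have p66 := h6.projectionEnd_mul_self
  have p56 := h.projectionEnd_five_mul_six h5 h6
  have p65 := h.projectionEnd_six_mul_five h5 h6
  have pp5 := h.left_mul_projectionEnd_five h5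
  have p5p := h.projectionEnd_five_mul_left h5
  have pp6 := h.left_mul_projectionEnd_six h6
  have p6p := h.projectionEnd_six_mul_left h6
  have z14 : (halmosH1 P Q).projectionEnd * (halmosH4 P Q).projectionEnd = 0 := by
    rw [e1, e4]; simp [mul_sub, sub_mul, p56, p5p, pp6, h.left_mul_self]
  have z15 : (halmosH1 P Q).projectionEnd * (halmosH5 P Q).projectionEnd = 0 := by
    rw [e1]; simp [sub_mul, p55, pp5]
  have z16 : (halmosH1 P Q).projectionEnd * (halmosH6 P Q).projectionEnd = 0 := by
    rw [e1]; simp [sub_mul, p56, pp6]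
  have z41 : (halmosH4 P Q).projectionEnd * (halmosH1 P Q).projectionEnd = 0 := by
    rw [e1, e4]; simp [mul_sub, sub_mul, p65, pp5, p6p, h.left_mul_self]
  have z45 : (halmosH4 P Q).projectionEnd * (halmosH5 P Q).projectionEnd = 0 := by
    rw [e4]; simp [sub_mul, p65, pp5]
  have z46 : (halmosH4 P Q).projectionEnd * (halmosH6 P Q).projectionEnd = 0 := by
    rw [e4]; simp [sub_mul, p66, pp6]
  have z51 : (halmosH5 P Q).projectionEnd * (halmosH1 P Q).projectionEnd = 0 := by
    rw [e1]; simp [mul_sub, p55, p5p]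
  have z54 : (halmosH5 P Q).projectionEnd * (halmosH4 P Q).projectionEnd = 0 := by
    rw [e4]; simp [mul_sub, p56, p5p]
  have z61 : (halmosH6 P Q).projectionEnd * (halmosH1 P Q).projectionEnd = 0 := by
    rw [e1]; simp [mul_sub, p65, p6p]
  have z64 : (halmosH6 P Q).projectionEnd * (halmosH4 P Q).projectionEnd = 0 := by
    rw [e4]; simp [mul_sub, p66, p6p]
  refine ⟨Adjointable.ext fun x => ?_, Adjointable.ext fun y => ?_⟩
  · rw [Adjointable.comp_apply, halmosUnitary_adjoint_apply h1 h4 h5 h6, halmosUnitary]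
    simp only [Adjointable.column_apply_fst, Adjointable.column_apply_snd]
    rw [← h1.projectionEnd_apply, ← h4.projectionEnd_apply, ← h5.projectionEnd_apply,
      ← h6.projectionEnd_apply, e1, e4]
    simp only [Adjointable.sub_apply, Adjointable.one_apply]
    change _ = x
    abel
  · rw [Adjointable.comp_apply, halmosUnitary_adjoint_apply h1 h4 h5 h6, halmosUnitary]
    change _ = y
    refine Adjointable.prod_ext ?_ (Adjointable.prod_ext ?_ (Adjointable.prod_ext ?_ ?_)) <;>
      simp only [Adjointable.column_apply_fst, Adjointable.column_apply_snd] <;>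
      simp only [map_add]
    · rw [h1.projection_coe, h1.projection_coe_eq_zero h4 z14, h1.projection_coe_eq_zero h5 z15,
        h1.projection_coe_eq_zero h6 z16, add_zero, add_zero, add_zero]
    · rw [h4.projection_coe, h4.projection_coe_eq_zero h1 z41, h4.projection_coe_eq_zero h5 z45,
        h4.projection_coe_eq_zero h6 z46, add_zero, add_zero, zero_add]
    · rw [h5.projection_coe, h5.projection_coe_eq_zero h1 z51, h5.projection_coe_eq_zero h4 z54,
        h5.projection_coe_eq_zero h6 p56, add_zero, zero_add, zero_add]
    · rw [h6.projection_coe, h6.projection_coe_eq_zero h1 z61, h6.projection_coe_eq_zero h4 z64,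
        h6.projection_coe_eq_zero h5 p65, zero_add, zero_add, zero_add]

/-- Reduces a conjugation formula to `TW* = W*D`, convenient because `W*` merely adds the four
components. -/
theorem halmosUnitary_conj_eq (h : IsMatchedPair P Q) (hharm : IsHarmonious P Q)
    {T : Adjointable 𝔄 H H} {D : Adjointable 𝔄 (HalmosSum P Q) (HalmosSum P Q)}
    (hTD : ∀ y, T ((halmosUnitary P Q).adjoint y) = (halmosUnitary P Q).adjoint (D y)) :
    ((halmosUnitary P Q).comp T).comp (halmosUnitary P Q).adjoint = D := by
  refine Adjointable.ext fun y => ?_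
  rw [Adjointable.comp_apply, Adjointable.comp_apply, hTD]
  exact congrArg (fun S : Adjointable 𝔄 (HalmosSum P Q) (HalmosSum P Q) => S (D y))
    (h.halmosUnitary_isUnitary hharm).2

theorem halmosUnitary_conj_left (h : IsMatchedPair P Q) (hharm : IsHarmonious P Q) :
    ((halmosUnitary P Q).comp P).comp (halmosUnitary P Q).adjoint =
      Adjointable.directSum 1 (Adjointable.directSum 0 (Adjointable.directSum 1 0)) := by
  have h1 := (h.halmosH1_complemented hharm.1).1
  have h4 := (h.halmosH4_complemented hharm.2).1
  refine h.halmosUnitary_conj_eq hharm fun y => ?_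
  rw [halmosUnitary_adjoint_apply h1 h4 hharm.1 hharm.2,
    halmosUnitary_adjoint_apply h1 h4 hharm.1 hharm.2]
  simp only [Adjointable.directSum_apply_fst, Adjointable.directSum_apply_snd, map_add,
    Adjointable.one_apply, Adjointable.zero_apply]
  have y1 : P (y.1 : H) = y.1 := h.apply_of_mem_range y.1.2.1
  have y4 : P (y.2.1 : H) = 0 := y.2.1.2.1
  have y5 : P (y.2.2.1 : H) = y.2.2.1 := by
    rw [← hharm.1.projectionEnd_apply_of_mem y.2.2.1.2, ← Adjointable.mul_apply,
      h.left_mul_projectionEnd_five hharm.1]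
  have y6 : P (y.2.2.2 : H) = 0 := by
    rw [← hharm.2.projectionEnd_apply_of_mem y.2.2.2.2, ← Adjointable.mul_apply,
      h.left_mul_projectionEnd_six hharm.2, Adjointable.zero_apply]
  rw [y1, y4, y5, y6]
  rfl

theorem halmosUnitary_conj_right (h : IsMatchedPair P Q) (hharm : IsHarmonious P Q) :
    ((halmosUnitary P Q).comp Q).comp (halmosUnitary P Q).adjoint =
      Adjointable.directSum 1 (Adjointable.directSum 0 (Adjointable.block
        (compression (halmosH5 P Q) (halmosH5 P Q) Q)
        (compression (halmosH5 P Q) (halmosH6 P Q) Q)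
        (compression (halmosH6 P Q) (halmosH5 P Q) Q)
        (compression (halmosH6 P Q) (halmosH6 P Q) Q))) := by
  have h1 := (h.halmosH1_complemented hharm.1).1
  have h4 := (h.halmosH4_complemented hharm.2).1
  obtain ⟨h5, h6⟩ := id hharm
  refine h.halmosUnitary_conj_eq hharm fun y => ?_
  rw [halmosUnitary_adjoint_apply h1 h4 h5 h6, halmosUnitary_adjoint_apply h1 h4 h5 h6]
  simp only [Adjointable.directSum_apply_fst, Adjointable.directSum_apply_snd,
    Adjointable.block_apply_fst, Adjointable.block_apply_snd, map_add,
    Adjointable.one_apply, Adjointable.zero_apply, Submodule.coe_add, Submodule.coe_zero]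
  have y1 : Q (y.1 : H) = y.1 := h.apply_of_mem_range_right y.1.2.2
  have y4 : Q (y.2.1 : H) = 0 := y.2.1.2.2
  have y5 : Q (y.2.2.1 : H) = (Q * (halmosH5 P Q).projectionEnd) y.2.2.1 := by
    rw [Adjointable.mul_apply, h5.projectionEnd_apply_of_mem y.2.2.1.2]
  have y6 : Q (y.2.2.2 : H) = (Q * (halmosH6 P Q).projectionEnd) y.2.2.2 := by
    rw [Adjointable.mul_apply, h6.projectionEnd_apply_of_mem y.2.2.2.2]
  rw [y1, y4, y5, y6, h.right_mul_projectionEnd_five h5 h6, h.right_mul_projectionEnd_six h5 h6,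
    h5.coe_compression_apply h5, h5.coe_compression_apply h6, h6.coe_compression_apply h5,
    h6.coe_compression_apply h6, Adjointable.add_apply, Adjointable.add_apply]
  abel

end IsMatchedPair

/-! ### Algebra and positivity of compressions -/

namespace CStarSubmodule

variable {𝔄 H : Type*} [NonUnitalCStarAlgebra 𝔄] [PartialOrder 𝔄] [StarOrderedRing 𝔄]
  [NormedAddCommGroup H] [NormedSpace ℂ H] [SMul 𝔄 H] [CStarModule 𝔄 H]

theorem IsOrthogonallyComplemented.compression_congr {M N : CStarSubmodule 𝔄 H}
    (hM : M.IsOrthogonallyComplemented) (hN : N.IsOrthogonallyComplemented)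
    {S T : Adjointable 𝔄 H H}
    (h : N.projectionEnd * S * M.projectionEnd = N.projectionEnd * T * M.projectionEnd) :
    compression N M S = compression N M T :=
  Adjointable.ext fun x => Subtype.ext <| by
    rw [hM.coe_compression_apply hN, hM.coe_compression_apply hN, h]

theorem adjoint_compression (M N : CStarSubmodule 𝔄 H) (T : Adjointable 𝔄 H H) :
    (compression N M T).adjoint = compression M N (star T) := rfl

theorem compression_comp_compression (L M N : CStarSubmodule 𝔄 H) (S T : Adjointable 𝔄 H H) :
    (compression L N S).comp (compression N M T) = compression L M (S * N.projectionEnd * T) :=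
  rfl

theorem compression_sub (M N : CStarSubmodule 𝔄 H) (S T : Adjointable 𝔄 H H) :
    compression N M (S - T) = compression N M S - compression N M T :=
  Adjointable.ext fun _ => map_sub N.projection.toCLM _ _

theorem compression_neg (M N : CStarSubmodule 𝔄 H) (T : Adjointable 𝔄 H H) :
    compression N M (-T) = -compression N M T :=
  Adjointable.ext fun _ => map_neg N.projection.toCLM _

theorem IsOrthogonallyComplemented.compression_one {M : CStarSubmodule 𝔄 H}
    (hM : M.IsOrthogonallyComplemented) : compression M M 1 = 1 :=
  hM.projection_comp_adjoint

/-- A factorization `T = c*c` restricts to maps from `M` to `H`, outside `𝓛(M)`; hence the test by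
inner products. -/
theorem compression_nonneg [CompleteSpace H] (M : CStarSubmodule 𝔄 H)
    [CompleteSpace M.toSubmodule] {T : Adjointable 𝔄 H H} (hT : 0 ≤ T) :
    0 ≤ compression M M T := by
  refine Adjointable.nonneg_of_inner_apply_nonneg ?_ fun x => ?_
  · rw [IsSelfAdjoint, show star (compression M M T) = compression M M (star T) from rfl,
      (IsSelfAdjoint.of_nonneg hT).star_eq]
  · have : inner 𝔄 (M.projection.adjoint x) (T (M.projection.adjoint x)) =
        inner 𝔄 x (compression M M T x) :=
      M.projection.adjoint.inner_adj x _
    rw [← this]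
    exact Adjointable.inner_apply_nonneg hT _

end CStarSubmodule

theorem Adjointable.denseRange_of_comp {𝔄 H K L : Type*} [NonUnitalCStarAlgebra 𝔄]
    [PartialOrder 𝔄] [StarOrderedRing 𝔄]
    [NormedAddCommGroup H] [NormedSpace ℂ H] [SMul 𝔄 H] [CStarModule 𝔄 H]
    [NormedAddCommGroup K] [NormedSpace ℂ K] [SMul 𝔄 K] [CStarModule 𝔄 K]
    [NormedAddCommGroup L] [NormedSpace ℂ L] [SMul 𝔄 L] [CStarModule 𝔄 L]
    {S : Adjointable 𝔄 K L} {T : Adjointable 𝔄 H K} (h : DenseRange (S.comp T).toCLM) :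
    DenseRange S.toCLM :=
  Dense.mono (by rintro _ ⟨x, rfl⟩; exact ⟨T x, rfl⟩) h

/-! ### The entries of `Q` on `H₅ ⊕ H₆` -/

namespace IsMatchedPair

open CStarSubmodule

variable {𝔄 H : Type*} [NonUnitalCStarAlgebra 𝔄] [PartialOrder 𝔄] [StarOrderedRing 𝔄]
  [NormedAddCommGroup H] [NormedSpace ℂ H] [CompleteSpace H] [SMul 𝔄 H] [CStarModule 𝔄 H]
  {P Q : Adjointable 𝔄 H H}

theorem projectionEnd_six_mul_mul_five (h : IsMatchedPair P Q) (hharm : IsHarmonious P Q) :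
    (halmosH6 P Q).projectionEnd * Q * (halmosH5 P Q).projectionEnd = (1 - P) * Q * P := by
  obtain ⟨h5, h6⟩ := hharm
  have e6 : (halmosH6 P Q).projectionEnd = (halmosH6 P Q).projectionEnd * (1 - P) := by
    rw [mul_sub, h.projectionEnd_six_mul_left h6, mul_one, sub_zero]
  calc (halmosH6 P Q).projectionEnd * Q * (halmosH5 P Q).projectionEnd
      = (halmosH6 P Q).projectionEnd * ((1 - P) * Q * P * (halmosH5 P Q).projectionEnd) := by
        rw [mul_assoc _ P, h.left_mul_projectionEnd_five h5]
        conv_lhs => rw [e6]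
        simp only [mul_assoc]
    _ = (1 - P) * Q * P := by rw [h.lowerCorner_mul_projectionEnd h5, h6.projectionEnd_mul]

theorem projectionEnd_five_mul_star_mul_six (h : IsMatchedPair P Q)
    (hharm : IsHarmonious P Q) :
    (halmosH5 P Q).projectionEnd * star Q * (halmosH6 P Q).projectionEnd =
      -((halmosH5 P Q).projectionEnd * Q * (halmosH6 P Q).projectionEnd) := by
  obtain ⟨h5, h6⟩ := hharm
  have e6 : (halmosH6 P Q).projectionEnd = (1 - P) * (halmosH6 P Q).projectionEnd := by
    rw [sub_mul, h.left_mul_projectionEnd_six h6, one_mul, sub_zero]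
  have key : ∀ X : Adjointable 𝔄 H H,
      (halmosH5 P Q).projectionEnd * X * (halmosH6 P Q).projectionEnd =
        (halmosH5 P Q).projectionEnd * (P * X * (1 - P)) * (halmosH6 P Q).projectionEnd := by
    intro X
    conv_lhs => rw [e6, ← h.projectionEnd_five_mul_left h5]
    simp only [mul_assoc]
  rw [key, key Q, h.mul_star_mul_one_sub, mul_neg, neg_mul]

theorem projectionEnd_five_mul_mul_five (h : IsMatchedPair P Q) (hharm : IsHarmonious P Q)
    (X : Adjointable 𝔄 H H) :
    (halmosH5 P Q).projectionEnd * X * (halmosH5 P Q).projectionEnd =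
      (halmosH5 P Q).projectionEnd * (P * X * P) * (halmosH5 P Q).projectionEnd := by
  calc (halmosH5 P Q).projectionEnd * X * (halmosH5 P Q).projectionEnd
      = (halmosH5 P Q).projectionEnd * P * X * (P * (halmosH5 P Q).projectionEnd) := by
        rw [h.projectionEnd_five_mul_left hharm.1, h.left_mul_projectionEnd_five hharm.1]
    _ = _ := by simp only [mul_assoc]

/-- The upper left entry of `Q² = Q`: since the upper right entry is `-B*`, it reads `A² - B*B = A`.
-/
theorem adjoint_comp_lower_eq (h : IsMatchedPair P Q) (hharm : IsHarmonious P Q) :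
    (compression (halmosH6 P Q) (halmosH5 P Q) Q).adjoint.comp
        (compression (halmosH6 P Q) (halmosH5 P Q) Q) =
      (compression (halmosH5 P Q) (halmosH5 P Q) Q - 1) *
        compression (halmosH5 P Q) (halmosH5 P Q) Q := by
  obtain ⟨h5, h6⟩ := id hharm
  have e : (compression (halmosH5 P Q) (halmosH5 P Q) Q - 1) *
        compression (halmosH5 P Q) (halmosH5 P Q) Q =
      compression (halmosH5 P Q) (halmosH5 P Q) (Q * (halmosH5 P Q).projectionEnd * Q - Q) := by
    rw [compression_sub, sub_mul, one_mul, ← compression_comp_compression]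
    rfl
  rw [e, adjoint_compression, compression_comp_compression]
  refine h5.compression_congr h5 ?_
  have h65 : (halmosH6 P Q).projectionEnd * Q * (halmosH5 P Q).projectionEnd =
      Q * (halmosH5 P Q).projectionEnd -
        (halmosH5 P Q).projectionEnd * Q * (halmosH5 P Q).projectionEnd := by
    rw [eq_sub_iff_add_eq', ← h.right_mul_projectionEnd_five h5 h6]
  have hQQ : ∀ X, Q * (Q * X) = Q * X := fun X => by rw [← mul_assoc, h.right_mul_self]
  calc (halmosH5 P Q).projectionEnd * (star Q * (halmosH6 P Q).projectionEnd * Q) *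
        (halmosH5 P Q).projectionEnd
      = (halmosH5 P Q).projectionEnd * star Q * (halmosH6 P Q).projectionEnd *
          (Q * (halmosH5 P Q).projectionEnd) := by simp only [mul_assoc]
    _ = -((halmosH5 P Q).projectionEnd * Q *
          ((halmosH6 P Q).projectionEnd * Q * (halmosH5 P Q).projectionEnd)) := by
        rw [h.projectionEnd_five_mul_star_mul_six hharm]; simp only [neg_mul, mul_assoc]
    _ = (halmosH5 P Q).projectionEnd * (Q * (halmosH5 P Q).projectionEnd * Q - Q) *
          (halmosH5 P Q).projectionEnd := by
        rw [h65]
        simp only [mul_sub, sub_mul, mul_assoc, hQQ, neg_sub]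

/-- The lower left entry of `Q² = Q`, namely `BA + DB = B`. -/
theorem lower_comp_eq (h : IsMatchedPair P Q) (hharm : IsHarmonious P Q) :
    (compression (halmosH6 P Q) (halmosH6 P Q) Q).comp
        (compression (halmosH6 P Q) (halmosH5 P Q) Q) =
      (compression (halmosH6 P Q) (halmosH5 P Q) Q).comp
        (1 - compression (halmosH5 P Q) (halmosH5 P Q) Q) := by
  obtain ⟨h5, h6⟩ := id hharm
  have e : (compression (halmosH6 P Q) (halmosH5 P Q) Q).comp
        (1 - compression (halmosH5 P Q) (halmosH5 P Q) Q) =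
      compression (halmosH6 P Q) (halmosH5 P Q) (Q - Q * (halmosH5 P Q).projectionEnd * Q) := by
    rw [compression_sub, ← compression_comp_compression]
    exact Adjointable.ext fun x => map_sub (compression (halmosH6 P Q) (halmosH5 P Q) Q).toCLM _ _
  rw [e, compression_comp_compression]
  refine h5.compression_congr h6 ?_
  have h65 : (halmosH6 P Q).projectionEnd * Q * (halmosH5 P Q).projectionEnd =
      Q * (halmosH5 P Q).projectionEnd -
        (halmosH5 P Q).projectionEnd * Q * (halmosH5 P Q).projectionEnd := by
    rw [eq_sub_iff_add_eq', ← h.right_mul_projectionEnd_five h5 h6]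
  have hQQ : ∀ X, Q * (Q * X) = Q * X := fun X => by rw [← mul_assoc, h.right_mul_self]
  calc (halmosH6 P Q).projectionEnd * (Q * (halmosH6 P Q).projectionEnd * Q) *
        (halmosH5 P Q).projectionEnd
      = (halmosH6 P Q).projectionEnd * Q *
          ((halmosH6 P Q).projectionEnd * Q * (halmosH5 P Q).projectionEnd) := by
        simp only [mul_assoc]
    _ = (halmosH6 P Q).projectionEnd * (Q - Q * (halmosH5 P Q).projectionEnd * Q) *
          (halmosH5 P Q).projectionEnd := by
        rw [h65]
        simp only [mul_sub, sub_mul, mul_assoc, hQQ]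

theorem upper_eq_neg_adjoint (h : IsMatchedPair P Q) (hharm : IsHarmonious P Q) :
    compression (halmosH5 P Q) (halmosH6 P Q) Q =
      -(compression (halmosH6 P Q) (halmosH5 P Q) Q).adjoint := by
  rw [adjoint_compression, ← compression_neg]
  refine hharm.2.compression_congr hharm.1 ?_
  rw [mul_neg, neg_mul, h.projectionEnd_five_mul_star_mul_six hharm, neg_neg]

theorem one_le_compression (h : IsMatchedPair P Q) (hharm : IsHarmonious P Q) :
    1 ≤ compression (halmosH5 P Q) (halmosH5 P Q) Q := by
  rw [← sub_nonneg, ← hharm.1.compression_one, ← compression_sub]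
  have : compression (halmosH5 P Q) (halmosH5 P Q) (Q - 1) =
      compression (halmosH5 P Q) (halmosH5 P Q) (P * Q * P - P) := by
    refine hharm.1.compression_congr hharm.1 ?_
    rw [h.projectionEnd_five_mul_mul_five hharm, mul_sub P, sub_mul _ _ P, mul_one,
      h.left_mul_self]
  rw [this]
  exact compression_nonneg _ (sub_nonneg.mpr h.le_compression)

/-- The range of `c*c` is dense in that of `c*`, which is the range of the upper corner and so dense
in `H₅`. As `c` is `B` seen in `𝓛(H)`, this transfers to `B*B`. -/
theorem denseRange_adjoint_comp_lower (h : IsMatchedPair P Q) (hharm : IsHarmonious P Q) :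
    DenseRange ((compression (halmosH6 P Q) (halmosH5 P Q) Q).adjoint.comp
      (compression (halmosH6 P Q) (halmosH5 P Q) Q)).toCLM := by
  set c := (1 - P) * Q * P with hc
  set B := compression (halmosH6 P Q) (halmosH5 P Q) Q
  have hcB : c = (halmosH6 P Q).projection.adjoint.comp (B.comp (halmosH5 P Q).projection) :=
    (h.projectionEnd_six_mul_mul_five hharm).symm
  have hdense : DenseRange ((halmosH5 P Q).projection.comp (star c * c)).toCLM := by
    refine hharm.1.denseRange_projection_comp fun x => ?_
    have : (P * Q * (1 - P)) x = (star c) (-x) := by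
      rw [hc, h.star_lowerCorner, Adjointable.neg_apply, map_neg, neg_neg]
    rw [this]
    exact Adjointable.star_apply_mem_closure_range c _
  refine Adjointable.denseRange_of_comp (S := B.adjoint.comp B)
    (T := (halmosH5 P Q).projection) ?_
  suffices h' : (B.adjoint.comp B).comp (halmosH5 P Q).projection =
      (halmosH5 P Q).projection.comp (star c * c) by rwa [h']
  refine Adjointable.ext fun x => ?_
  rw [hcB]
  change B.adjoint (B ((halmosH5 P Q).projection x)) =
    ((halmosH5 P Q).projection.comp (halmosH5 P Q).projection.adjoint) (B.adjoint
      (((halmosH6 P Q).projection.comp (halmosH6 P Q).projection.adjoint)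
        (B ((halmosH5 P Q).projection x))))
  rw [hharm.1.projection_comp_adjoint, hharm.2.projection_comp_adjoint]
  rfl

theorem denseRange_lower (h : IsMatchedPair P Q) (hharm : IsHarmonious P Q) :
    DenseRange (compression (halmosH6 P Q) (halmosH5 P Q) Q).toCLM := by
  refine Adjointable.denseRange_of_comp (S := compression (halmosH6 P Q) (halmosH5 P Q) Q)
    (T := (halmosH5 P Q).projection) ?_
  have hdense := hharm.2.denseRange_projection_comp (S := (1 - P) * Q * P)
    (fun x => subset_closure ⟨x, rfl⟩)
  suffices h' : (compression (halmosH6 P Q) (halmosH5 P Q) Q).comp (halmosH5 P Q).projection =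
      (halmosH6 P Q).projection.comp ((1 - P) * Q * P) by rwa [h']
  refine Adjointable.ext fun x => ?_
  rw [← h.projectionEnd_six_mul_mul_five hharm]
  change _ = ((halmosH6 P Q).projection.comp (halmosH6 P Q).projection.adjoint)
    (compression (halmosH6 P Q) (halmosH5 P Q) Q ((halmosH5 P Q).projection x))
  rw [hharm.2.projection_comp_adjoint]
  rfl

/-- The block decomposition of a matched pair. -/
theorem exists_block_decomposition (h : IsMatchedPair P Q) (hharm : IsHarmonious P Q) :
    ∃ (A : Adjointable 𝔄 (halmosH5 P Q) (halmosH5 P Q))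
      (U : Adjointable 𝔄 (halmosH5 P Q) (halmosH6 P Q)),
      U.IsUnitary ∧ 1 ≤ A ∧ DenseRange (A - 1).toCLM ∧
      ((halmosUnitary P Q).comp Q).comp (halmosUnitary P Q).adjoint =
        Adjointable.directSum 1 (Adjointable.directSum 0
          (Adjointable.block
            A (-(CFC.sqrt A * CFC.sqrt (A - 1)).comp U.adjoint)
            (U.comp (CFC.sqrt A * CFC.sqrt (A - 1))) ((U.comp (1 - A)).comp U.adjoint))) := by
  have hBB := h.adjoint_comp_lower_eq hharm
  have hDB := h.lower_comp_eq hharm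
  have hB' := h.upper_eq_neg_adjoint hharm
  have h1A := h.one_le_compression hharm
  have hdense := h.denseRange_adjoint_comp_lower hharm
  rw [h.halmosUnitary_conj_right hharm, hB']
  set A := compression (halmosH5 P Q) (halmosH5 P Q) Q
  set B := compression (halmosH6 P Q) (halmosH5 P Q) Q
  set D := compression (halmosH6 P Q) (halmosH6 P Q) Q
  have hA0 : 0 ≤ A := zero_le_one.trans h1A
  have hA1 : 0 ≤ A - 1 := sub_nonneg.mpr h1A
  have hAA : Commute A (A - 1) := (Commute.refl A).sub_right (Commute.one_right A)
  have hs1 : Commute (CFC.sqrt A) (A - 1) := hAA.cfcₙ_nnreal _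
  have hs2 : Commute (CFC.sqrt A) (CFC.sqrt (A - 1)) := (hs1.symm.cfcₙ_nnreal _).symm
  have hCA : Commute (CFC.sqrt A * CFC.sqrt (A - 1)) A :=
    Commute.mul_left ((Commute.refl A).cfcₙ_nnreal _) (hAA.symm.cfcₙ_nnreal _)
  have hCs : star (CFC.sqrt A * CFC.sqrt (A - 1)) = CFC.sqrt A * CFC.sqrt (A - 1) :=
    (IsSelfAdjoint.of_nonneg (hs2.mul_nonneg (CFC.sqrt_nonneg _) (CFC.sqrt_nonneg _))).star_eq
  have hCC : CFC.sqrt A * CFC.sqrt (A - 1) * (CFC.sqrt A * CFC.sqrt (A - 1)) = (A - 1) * A := by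
    rw [hs2.symm.mul_mul_mul_comm, CFC.sqrt_mul_sqrt_self A, CFC.sqrt_mul_sqrt_self (A - 1), hAA.eq]
  -- `C` is the modulus of `B`: positive, with square `(A - 1)A = B*B`. Its range contains that of
  -- `C²`, so it is dense.
  set C := CFC.sqrt A * CFC.sqrt (A - 1)
  have hCadj : C.adjoint = C := hCs
  have hCB : C.adjoint.comp C = B.adjoint.comp B := by
    rw [hBB, hCadj]
    exact hCC
  have hCd : DenseRange C.toCLM := by
    rw [← hCB, hCadj] at hdense
    exact Adjointable.denseRange_of_comp hdense
  obtain ⟨U, hU, hUC⟩ := Adjointable.exists_isUnitary_comp_eq hCd (h.denseRange_lower hharm) hCB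
  replace hUC : U.comp C = B := hUC
  refine ⟨A, U, hU, h1A, ?_, ?_⟩
  -- The range of `A - 1` contains that of `(A - 1)A = B*B`.
  · rw [hBB] at hdense
    exact Adjointable.denseRange_of_comp hdense
  -- `DUC = DB = B(1 - A) = UC(1 - A) = U(1 - A)C`, and `C` can be cancelled because its range is
  -- dense.
  have hDU : D.comp U = U.comp (1 - A) := by
    refine Adjointable.eq_of_comp_eq_of_denseRange hCd ?_
    have e : C.comp (1 - A) = (1 - A).comp C := ((Commute.one_right C).sub_right hCA).eq
    calc (D.comp U).comp C = D.comp (U.comp C) := rfl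
      _ = U.comp (C.comp (1 - A)) := by rw [hUC, hDB, ← hUC]; rfl
      _ = (U.comp (1 - A)).comp C := by rw [e]; rfl
  have hD : D = (U.comp (1 - A)).comp U.adjoint := by
    rw [← hDU]
    exact (congrArg (fun T => D.comp T) hU.2).symm
  have hBadj : B.adjoint = C.comp U.adjoint := by
    rw [← hUC]
    exact congrArg (fun T => Adjointable.comp T U.adjoint) hCadj
  rw [hBadj, hUC, ← hD]

end IsMatchedPair

end

/-! ### The theorem for the pair `(m(Q), Q)` -/

theorem mainTheorem7 {𝔄 H : Type*}
    [NonUnitalCStarAlgebra 𝔄] [PartialOrder 𝔄] [StarOrderedRing 𝔄]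
    [NormedAddCommGroup H] [NormedSpace ℂ H] [CompleteSpace H] [SMul 𝔄 H] [CStarModule 𝔄 H]
    (Q : Adjointable 𝔄 H H) (hQ : IsIdempotentElem Q) (hQ' : ¬ IsStarProjection Q)
    (hharm : IsHarmonious (matchedProjection Q) Q) :
    ((halmosH1 (matchedProjection Q) Q).IsOrthogonallyComplemented ∧
      (halmosH4 (matchedProjection Q) Q).IsOrthogonallyComplemented ∧
      halmosH2 (matchedProjection Q) Q = ⊥ ∧ halmosH3 (matchedProjection Q) Q = ⊥ ∧
      (halmosUnitary (matchedProjection Q) Q).IsUnitary) ∧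
    ((halmosUnitary (matchedProjection Q) Q).comp (matchedProjection Q)).comp
        (halmosUnitary (matchedProjection Q) Q).adjoint =
      Adjointable.directSum 1 (Adjointable.directSum 0 (Adjointable.directSum 1 0)) ∧
    ∃ (A : Adjointable 𝔄 (halmosH5 (matchedProjection Q) Q) (halmosH5 (matchedProjection Q) Q))
      (U : Adjointable 𝔄 (halmosH5 (matchedProjection Q) Q) (halmosH6 (matchedProjection Q) Q)),
      U.IsUnitary ∧ 1 ≤ A ∧ DenseRange (A - 1).toCLM ∧
      ((halmosUnitary (matchedProjection Q) Q).comp Q).comp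
          (halmosUnitary (matchedProjection Q) Q).adjoint =
        Adjointable.directSum 1 (Adjointable.directSum 0
          (Adjointable.block
            A (-(CFC.sqrt A * CFC.sqrt (A - 1)).comp U.adjoint)
            (U.comp (CFC.sqrt A * CFC.sqrt (A - 1))) ((U.comp (1 - A)).comp U.adjoint))) := by
  obtain ⟨hs, hPP, hJ, hle, hnp⟩ := matchedProjection_properties hQ
  have h : IsMatchedPair (matchedProjection Q) Q := ⟨hs, hPP, hQ, hJ, hle, hnp⟩
  exact ⟨⟨(h.halmosH1_complemented hharm.1).1, (h.halmosH4_complemented hharm.2).1,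
    h.halmosH2_eq_bot, h.halmosH3_eq_bot, h.halmosUnitary_isUnitary hharm⟩,
    h.halmosUnitary_conj_left hharm, h.exists_block_decomposition hharm⟩
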